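/- Let $M$ be a smooth manifold, $L\to M$ a smooth real vector bundle of finite rank, and let $E=L\oplus L^*$ carry the fibre metric $\langle s+\sigma,t+\tau\rangle=\sigma(t)+\tau(s)$. Let $E$ be a Courant algebroid: there are a vector bundle map $\rho\colon E\to TM$ and a bracket $[\cdot,\cdot]$ on $\Gamma(E)$ such that, for all $a,b,c\in\Gamma(E)$, $$[a,[b,c]]=[[a,b],c]+[b,[a,c]],\qquad [a,b]+[b,a]=\mathcal D\langle a,b\rangle,\qquad \rho(a)\langle b,c\rangle=\langle[a,b],c\rangle+\langle b,[a,c]\rangle,$$ where $\mathcal D f\in\Gamma(E)$ is defined by $\langle\mathcal D f,e\rangle=\rho(e)f$. Assume that $L\subseteq E$ is a Dirac structure, i.e. a maximally isotropic subbundle whose sections are closed under the bracket. Denote by $d_L\colon\Gamma(\Lambda^kL^*)\to\Gamma(\Lambda^{k+1}L^*)$ the differential of the Lie algebroid $(L,[\cdot,\cdot]|_L,\rho|_L)$, by $[\cdot,\cdot]_\gamma$ the Schouten–Nijenhuis bracket on $\Gamma(\Lambda^\bullet L^*)$ defined by the bracket $[\sigma,\tau]_{L^*}=\mathrm{pr}_{L^*}[\sigma,\tau]$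 on $\Gamma(L^*)$ and the anchor $\rho|_{L^*}$, and by $[\cdot,\cdot,\cdot]_\phi\colon\Gamma(\Lambda^2L^*)^3\to\Gamma(\Lambda^3L^*)$ the symmetric $C^\infty(M)$-trilinear map $$[\eta_1,\eta_2,\eta_3]_\phi(s_1,s_2,s_3)=-\sum_{\pi\in S_3}\phi\big(\eta_{\pi(1)}(s_1),\eta_{\pi(2)}(s_2),\eta_{\pi(3)}(s_3)\big),\qquad \phi(\sigma,\tau,\upsilon)=-\langle[\sigma,\tau],\upsilon\rangle,$$ where $\eta(s)=\eta(s,\cdot)\in\Gamma(L^*)$. A formal deformation of $L$ of order $N$ is a polynomial $\omega_t=t\omega_1+\dots+t^N\omega_N$ with $\omega_i\in\Gamma(\Lambda^2L^*)$ such that the coefficients of $t^0,\dots,t^N$ in $$d_L\omega_t+\tfrac12[\omega_t,\omega_t]_\gamma+\tfrac16[\omega_t,\omega_t,\omega_t]_\phi$$ vanish. It extends to order $N+1$ if there is $\omega_{N+1}\in\Gamma(\Lambda^2L^*)$ such that $\omega_t+t^{N+1}\omega_{N+1}$ is a formal deformation of order $N+1$. **Theorem.** Let $\omega_t=t\omega_1+\dots+t^N\omega_N$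 be a formal deformation of $L$ of order $N$. Then $$R_{N+1}=-\frac12\sum_{i=1}^N[\omega_i,\omega_{N+1-i}]_\gamma-\frac16\sum_{\substack{i,j,k\ge1\\ i+j+k=N+1}}[\omega_i,\omega_j,\omega_k]_\phi\ \in\ \Gamma(\Lambda^3L^*)$$ satisfies $d_LR_{N+1}=0$. Moreover, $\omega_t$ extends to a formal deformation of order $N+1$ if and only if $R_{N+1}=d_L\eta$ for some $\eta\in\Gamma(\Lambda^2L^*)$; equivalently, if and only if the class of $R_{N+1}$ vanishes in the third Lie algebroid cohomology $$H^3(L)=\ker\big(d_L|_{\Gamma(\Lambda^3L^*)}\big)\big/d_L\Gamma(\Lambda^2L^*).$$ -/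

import Mathlib

open Bundle
open scoped Manifold ContDiff Topology

set_option linter.unusedSectionVars false

noncomputable section

namespace DiracDeformation
section Algebra

variable {R P : Type*} [CommRing R] [AddCommGroup P] [Module R P]

theorem vec2_eq_update {X : Type*} (a b c : X) : ![a, c] = Function.update ![a, b] 1 c := by
  funext i; fin_cases i <;> rfl

/-- An alternating trilinear map from a function of three variables that is linear in the first
one and skew-symmetric under adjacent transpositions. -/
def mkAlt3 (g : P → P → P → R) (h2 : ∀ r : R, r = -r → r = 0)
    (hadd : ∀ a a' b c, g (a + a') b c = g a b c + g a' b c)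
    (hsmul : ∀ (r : R) a b c, g (r • a) b c = r * g a b c)
    (h01 : ∀ a b c, g b a c = -g a b c) (h12 : ∀ a b c, g a c b = -g a b c) :
    P [⋀^Fin 3]→ₗ[R] R where
  toFun s := g (s 0) (s 1) (s 2)
  map_update_add' := by
    intro inst s i a b
    obtain rfl : inst = instDecidableEqFin 3 := Subsingleton.elim _ _
    have e1 : ∀ p a a' q, g p (a + a') q = g p a q + g p a' q := fun p a a' q => by
      linear_combination h01 (a + a') p q - hadd a a' p q - h01 a p q - h01 a' p q
    have e2 : ∀ p q a a', g p q (a + a') = g p q a + g p q a' := fun p q a a' => by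
      linear_combination h12 p (a + a') q - e1 p a a' q - h12 p a q - h12 p a' q
    fin_cases i <;> simp [hadd, e1, e2]
  map_update_smul' := by
    intro inst s i r a
    obtain rfl : inst = instDecidableEqFin 3 := Subsingleton.elim _ _
    have e1 : ∀ p (r : R) a q, g p (r • a) q = r * g p a q := fun p r a q => by
      linear_combination h01 (r • a) p q - hsmul r a p q - r * h01 a p q
    have e2 : ∀ p q (r : R) a, g p q (r • a) = r * g p q a := fun p q r a => by
      linear_combination h12 p (r • a) q - e1 p r a q - r * h12 p a q
    fin_cases i <;> simp [hsmul, e1, e2]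
  map_eq_zero_of_eq' s i j h hij := by
    have e01 : ∀ a c, g a a c = 0 := fun a c => h2 _ (h01 a a c)
    have e12 : ∀ a c, g a c c = 0 := fun a c => h2 _ (h12 a c c)
    have e02 : ∀ a c, g a c a = 0 := fun a c => by rw [h12, e01, neg_zero]
    fin_cases i <;> fin_cases j <;> simp at hij h ⊢ <;> simp [h, e01, e12, e02]

theorem mkAlt3_apply (g : P → P → P → R) (h2 : ∀ r : R, r = -r → r = 0)
    (hadd : ∀ a a' b c, g (a + a') b c = g a b c + g a' b c)
    (hsmul : ∀ (r : R) a b c, g (r • a) b c = r * g a b c)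
    (h01 : ∀ a b c, g b a c = -g a b c) (h12 : ∀ a b c, g a c b = -g a b c) (s : Fin 3 → P) :
    mkAlt3 g h2 hadd hsmul h01 h12 s = g (s 0) (s 1) (s 2) := rfl

/-- An alternating map of four variables, as in `mkAlt3`. -/
def mkAlt4 (g : P → P → P → P → R) (h2 : ∀ r : R, r = -r → r = 0)
    (hadd : ∀ a a' b c d, g (a + a') b c d = g a b c d + g a' b c d)
    (hsmul : ∀ (r : R) a b c d, g (r • a) b c d = r * g a b c d)
    (h01 : ∀ a b c d, g b a c d = -g a b c d) (h12 : ∀ a b c d, g a c b d = -g a b c d)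
    (h23 : ∀ a b c d, g a b d c = -g a b c d) :
    P [⋀^Fin 4]→ₗ[R] R where
  toFun s := g (s 0) (s 1) (s 2) (s 3)
  map_update_add' := by
    intro inst s i a b
    obtain rfl : inst = instDecidableEqFin 4 := Subsingleton.elim _ _
    have e1 : ∀ p a a' q r, g p (a + a') q r = g p a q r + g p a' q r := fun p a a' q r => by
      linear_combination h01 (a + a') p q r - hadd a a' p q r - h01 a p q r - h01 a' p q r
    have e2 : ∀ p q a a' r, g p q (a + a') r = g p q a r + g p q a' r := fun p q a a' r => by
      linear_combination h12 p (a + a') q r - e1 p a a' q r - h12 p a q r - h12 p a' q r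
    have e3 : ∀ p q r a a', g p q r (a + a') = g p q r a + g p q r a' := fun p q r a a' => by
      linear_combination h23 p q (a + a') r - e2 p q a a' r - h23 p q a r - h23 p q a' r
    fin_cases i <;> simp [hadd, e1, e2, e3]
  map_update_smul' := by
    intro inst s i r a
    obtain rfl : inst = instDecidableEqFin 4 := Subsingleton.elim _ _
    have e1 : ∀ p (r : R) a q u, g p (r • a) q u = r * g p a q u := fun p r a q u => by
      linear_combination h01 (r • a) p q u - hsmul r a p q u - r * h01 a p q u
    have e2 : ∀ p q (r : R) a u, g p q (r • a) u = r * g p q a u := fun p q r a u => by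
      linear_combination h12 p (r • a) q u - e1 p r a q u - r * h12 p a q u
    have e3 : ∀ p q u (r : R) a, g p q u (r • a) = r * g p q u a := fun p q u r a => by
      linear_combination h23 p q (r • a) u - e2 p q r a u - r * h23 p q a u
    fin_cases i <;> simp [hsmul, e1, e2, e3]
  map_eq_zero_of_eq' s i j h hij := by
    have e01 : ∀ a c d, g a a c d = 0 := fun a c d => h2 _ (h01 a a c d)
    have e12 : ∀ a c d, g a c c d = 0 := fun a c d => h2 _ (h12 a c c d)
    have e23 : ∀ a c d, g a c d d = 0 := fun a c d => h2 _ (h23 a c d d)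
    have e02 : ∀ a c d, g a c a d = 0 := fun a c d => by rw [h12, e01, neg_zero]
    have e13 : ∀ a c d, g a c d c = 0 := fun a c d => by rw [h23, e12, neg_zero]
    have e03 : ∀ a c d, g a c d a = 0 := fun a c d => by rw [h23, e02, neg_zero]
    fin_cases i <;> fin_cases j <;> simp at hij h ⊢ <;> simp [h, e01, e12, e23, e02, e13, e03]

theorem mkAlt4_apply (g : P → P → P → P → R) (h2 : ∀ r : R, r = -r → r = 0)
    (hadd : ∀ a a' b c d, g (a + a') b c d = g a b c d + g a' b c d)
    (hsmul : ∀ (r : R) a b c d, g (r • a) b c d = r * g a b c d)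
    (h01 : ∀ a b c d, g b a c d = -g a b c d) (h12 : ∀ a b c d, g a c b d = -g a b c d)
    (h23 : ∀ a b c d, g a b d c = -g a b c d) (s : Fin 4 → P) :
    mkAlt4 g h2 hadd hsmul h01 h12 h23 s = g (s 0) (s 1) (s 2) (s 3) := rfl

end Algebra

theorem alt2_props {R P : Type*} [CommRing R] [AddCommGroup P] [Module R P]
    (g : P [⋀^Fin 2]→ₗ[R] R) :
    (∀ a a' b, g ![a + a', b] = g ![a, b] + g ![a', b]) ∧
    (∀ (r : R) a b, g ![r • a, b] = r * g ![a, b]) ∧ (∀ a b, g ![b, a] = -g ![a, b]) := by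
  refine ⟨fun a a' b => ?_, fun r a b => ?_, fun a b => ?_⟩
  · have := g.map_update_add ![0, b] 0 a a'
    have h (x : P) : ![x, b] = Function.update ![0, b] 0 x := by
      funext i; fin_cases i <;> rfl
    rw [h, this, ← h, ← h]
  · have := g.map_update_smul ![0, b] 0 r a
    have h (x : P) : ![x, b] = Function.update ![0, b] 0 x := by
      funext i; fin_cases i <;> rfl
    rw [h, this, ← h, smul_eq_mul]
  · have h : ![b, a] = ![a, b] ∘ Equiv.swap (0 : Fin 2) 1 := by funext i; fin_cases i <;> rfl
    rw [h, g.map_swap _ (by decide)]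

theorem alt3_props {R P : Type*} [CommRing R] [AddCommGroup P] [Module R P]
    (g : P [⋀^Fin 3]→ₗ[R] R) :
    (∀ a a' b c, g ![a + a', b, c] = g ![a, b, c] + g ![a', b, c]) ∧
    (∀ (r : R) a b c, g ![r • a, b, c] = r * g ![a, b, c]) ∧
    (∀ a b c, g ![b, a, c] = -g ![a, b, c]) ∧ (∀ a b c, g ![a, c, b] = -g ![a, b, c]) := by
  refine ⟨fun a a' b c => ?_, fun r a b c => ?_, fun a b c => ?_, fun a b c => ?_⟩
  · have := g.map_update_add ![0, b, c] 0 a a'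
    have h (x : P) : ![x, b, c] = Function.update ![0, b, c] 0 x := by
      funext i; fin_cases i <;> rfl
    rw [h, this, ← h, ← h]
  · have := g.map_update_smul ![0, b, c] 0 r a
    have h (x : P) : ![x, b, c] = Function.update ![0, b, c] 0 x := by
      funext i; fin_cases i <;> rfl
    rw [h, this, ← h, smul_eq_mul]
  · have h : ![b, a, c] = ![a, b, c] ∘ Equiv.swap (0 : Fin 3) 1 := by
      funext i; fin_cases i <;> rfl
    rw [h, g.map_swap _ (by decide)]
  · have h : ![a, c, b] = ![a, b, c] ∘ Equiv.swap (1 : Fin 3) 2 := by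
      funext i; fin_cases i <;> rfl
    rw [h, g.map_swap _ (by decide)]


abbrev SmoothFn {EM : Type*} [NormedAddCommGroup EM] [NormedSpace ℝ EM]
    {HM : Type*} [TopologicalSpace HM] (I : ModelWithCorners ℝ EM HM)
    (M : Type*) [TopologicalSpace M] [ChartedSpace HM M] : Type _ :=
  C^∞⟮I, M; 𝓘(ℝ, ℝ), ℝ⟯

section General

variable {EM : Type*} [NormedAddCommGroup EM] [NormedSpace ℝ EM]
  {HM : Type*} [TopologicalSpace HM] (I : ModelWithCorners ℝ EM HM)
  {M : Type*} [TopologicalSpace M] [ChartedSpace HM M]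
  (F : Type*) [NormedAddCommGroup F] [NormedSpace ℝ F]
  (E : M → Type*) [TopologicalSpace (TotalSpace F E)]
  [∀ x, AddCommGroup (E x)] [∀ x, Module ℝ (E x)] [∀ x, TopologicalSpace (E x)]
  [FiberBundle F E] [VectorBundle ℝ F E]

abbrev Sec : Type _ := Cₛ^∞⟮I; F, E⟯

variable {I F E}

instance : SMul (SmoothFn I M) (Sec I F E) :=
  ⟨fun f s => ⟨fun x => f x • s x, f.contMDiff.smul_section s.contMDiff⟩⟩

@[simp] theorem smulSec_apply (f : SmoothFn I M) (s : Sec I F E) (x : M) :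
    (f • s) x = f x • s x := rfl
@[simp] theorem addSec_apply (s t : Sec I F E) (x : M) : (s + t) x = s x + t x := rfl
@[simp] theorem zeroSec_apply (x : M) : (0 : Sec I F E) x = 0 := rfl
@[simp] theorem negSec_apply (s : Sec I F E) (x : M) : (-s) x = -s x := rfl
@[simp] theorem subSec_apply (s t : Sec I F E) (x : M) : (s - t) x = s x - t x := rfl
@[simp] theorem rsmulSec_apply (c : ℝ) (s : Sec I F E) (x : M) : (c • s) x = c • s x := rfl

theorem sumSec_apply {ι : Type*} (t : Finset ι) (s : ι → Sec I F E) (x : M) :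
    (∑ i ∈ t, s i) x = ∑ i ∈ t, s i x := by
  rw [← ContMDiffSection.coeAddHom_apply, map_sum, Finset.sum_apply]
  rfl

/-- The sections `Γ(E)` form a module over `C^∞(M)`. -/
instance : Module (SmoothFn I M) (Sec I F E) where
  one_smul s := by ext x; simp
  mul_smul f g s := by ext x; simp [mul_smul]
  smul_zero f := by ext x; simp
  smul_add f s t := by ext x; simp
  add_smul f g s := by ext x; simp [add_smul]
  zero_smul s := by ext x; simp

/-- A smooth local frame around `x`, cut off by a bump function `χ` to global sections `u i`,
together with the (cut off) coefficient functions `c i s` of a section `s`. -/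
theorem exists_cutoff_frame [FiniteDimensional ℝ EM] [T2Space M] [IsManifold I ∞ M]
    [FiniteDimensional ℝ F] [ContMDiffVectorBundle ∞ F E I] (x : M) :
    ∃ (n : ℕ) (χ : SmoothFn I M) (u : Fin n → Sec I F E)
      (c : Fin n → Sec I F E → SmoothFn I M), χ x = 1 ∧
      (∀ s, (χ * χ) • s = ∑ i, c i s • u i) ∧ (∀ s, s x = 0 → ∀ i, c i s x = 0) ∧
      ∀ v : E x, ∃ a : Fin n → ℝ, v = ∑ i, a i • u i x := by
  let b := Module.finBasis ℝ F
  let e := trivializationAt F E x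
  have hx : x ∈ e.baseSet := FiberBundle.mem_baseSet_trivializationAt F E x
  have : ContMDiffVectorBundle 1 F E I := ContMDiffVectorBundle.of_le (n := ∞) (by simp)
  obtain ⟨χ, -, hχ⟩ := (SmoothBumpFunction.nhds_basis_tsupport (I := I) x).mem_iff.1
    (e.open_baseSet.mem_nhds hx)
  have h0 : ∀ y, y ∉ e.baseSet → χ y = 0 := fun y hy =>
    image_eq_zero_of_notMem_tsupport fun h => hy (hχ h)
  refine ⟨_, ⟨χ, χ.contMDiff⟩, fun i => ⟨fun y => χ y • e.localFrame b i y,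
    (ContMDiffOn.smul_section_of_tsupport χ.contMDiff.contMDiffOn e.open_baseSet hχ
      (e.contMDiffOn_localFrame_baseSet ∞ b i))⟩,
    fun i s => ⟨fun y => χ y * e.localFrameCoeff I b i y (s y), ?_⟩, χ.eq_one, ?_, ?_, ?_⟩
  · have h1 : ContMDiffOn I 𝓘(ℝ, ℝ) ∞ (fun y => χ y * e.localFrameCoeff I b i y (s y))
        e.baseSet :=
      χ.contMDiff.contMDiffOn.mul
        (contMDiffOn_baseSet_localFrameCoeff b s.contMDiff.contMDiffOn i)
    refine contMDiff_of_tsupport fun y hy => ?_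
    exact h1.contMDiffAt (e.open_baseSet.mem_nhds (hχ (tsupport_mul_subset_left hy)))
  · intro s
    ext y
    rw [sumSec_apply]
    change (χ y * χ y) • s y =
      ∑ i, (χ y * e.localFrameCoeff I b i y (s y)) • (χ y • e.localFrame b i y)
    by_cases hy : y ∈ e.baseSet
    · conv_lhs => rw [e.eq_sum_localFrameCoeff_smul (I := I) (b := b) (s := s) hy]
      rw [Finset.smul_sum]
      refine Finset.sum_congr rfl fun i _ => ?_
      rw [smul_smul, smul_smul]
      congr 1
      ring
    · simp [h0 y hy]
  · intro s hs i
    change χ x * _ = 0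
    simp [hs]
  · intro v
    refine ⟨fun i => e.basisAt b hx |>.repr v i, ?_⟩
    conv_lhs => rw [← (e.basisAt b hx).sum_repr v]
    refine Finset.sum_congr rfl fun i _ => ?_
    change _ = _ • (χ x • e.localFrame b i x)
    simp [hx]

section Extension

variable [FiniteDimensional ℝ EM] [T2Space M] [IsManifold I ∞ M]
  [FiniteDimensional ℝ F] [ContMDiffVectorBundle ∞ F E I]

/-- Locally constant sections, in a trivialization around `x`, extend from a neighbourhood of `x`
to global smooth sections. -/
theorem exists_sec_eventuallyEq (x : M) (w : F) : ∃ u : Sec I F E, ∀ᶠ y in 𝓝 x,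
    u y = (trivializationAt F E x).symmL ℝ y w := by
  let e := trivializationAt F E x
  have hx : x ∈ e.baseSet := FiberBundle.mem_baseSet_trivializationAt F E x
  obtain ⟨χ, -, hχ⟩ := (SmoothBumpFunction.nhds_basis_tsupport (I := I) x).mem_iff.1
    (e.open_baseSet.mem_nhds hx)
  have h1 : ContMDiffOn I (I.prod 𝓘(ℝ, F)) ∞ (fun y => TotalSpace.mk' F y (e.symmL ℝ y w))
      e.baseSet := by
    rw [e.contMDiffOn_section_baseSet_iff]
    refine (contMDiffOn_const (c := w)).congr fun y hy => ?_
    rw [e.symmL_apply hy]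
    exact congrArg Prod.snd (e.apply_mk_symm hy w)
  refine ⟨⟨_, ContMDiffOn.smul_section_of_tsupport χ.contMDiff.contMDiffOn e.open_baseSet hχ h1⟩,
    ?_⟩
  filter_upwards [χ.eventuallyEq_one] with y hy
  change χ y • e.symmL ℝ y w = _
  rw [hy, Pi.one_apply, one_smul]

/-- Evaluation of sections at a point. -/
def evalAt (x : M) : Sec I F E →ₗ[ℝ] E x where
  toFun s := s x
  map_add' _ _ := rfl
  map_smul' _ _ := rfl

theorem evalAt_surjective (x : M) : Function.Surjective (evalAt (I := I) (F := F) (E := E) x) := by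
  obtain ⟨n, χ, u, c, -, -, -, h⟩ := exists_cutoff_frame (I := I) (F := F) (E := E) x
  intro v
  obtain ⟨a, ha⟩ := h v
  exact ⟨∑ i, a i • u i, by rw [map_sum, ha]; rfl⟩

/-- A linear choice of global sections through the vectors of the fibre at `x`. -/
def extendSec (x : M) : E x →ₗ[ℝ] Sec I F E :=
  ((evalAt x).exists_rightInverse_of_surjective
    (LinearMap.range_eq_top.2 (evalAt_surjective x))).choose

@[simp] theorem extendSec_apply (x : M) (v : E x) :
    (extendSec x v : Sec I F E) x = v :=
  LinearMap.congr_fun ((evalAt (I := I) (F := F) (E := E) x).exists_rightInverse_of_surjective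
    (LinearMap.range_eq_top.2 (evalAt_surjective x))).choose_spec v

/-- A `C^∞(M)`-multilinear map on sections depends at `x` only on the values of the sections
at `x`. -/
theorem alt_congr_at {k : ℕ}
    (g : Sec I F E [⋀^Fin k]→ₗ[SmoothFn I M] SmoothFn I M) (x : M)
    (s s' : Fin k → Sec I F E) (h : ∀ i, s i x = s' i x) : g s x = g s' x := by
  classical
  have key : ∀ (s : Fin k → Sec I F E) (i : Fin k) (w : Sec I F E), w x = 0 →
      g (Function.update s i w) x = 0 := by
    intro s i w hw
    obtain ⟨n, χ, u, c, h1, h2, h3, -⟩ := exists_cutoff_frame (I := I) (F := F) (E := E) x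
    have e1 : g (Function.update s i ((χ * χ) • w)) x = g (Function.update s i w) x := by
      rw [g.map_update_smul]
      change (χ x * χ x) * _ = _
      rw [h1]; ring
    rw [← e1, h2, g.map_update_sum]
    change (ContMDiffMap.coeFnAddMonoidHom (I := I) (I' := 𝓘(ℝ, ℝ)) (n := ∞) _) x = 0
    rw [map_sum, Finset.sum_apply]
    refine Finset.sum_eq_zero fun j _ => ?_
    rw [g.map_update_smul]
    change c j w x * _ = 0
    rw [h3 w hw, zero_mul]
  have step : ∀ (s : Fin k → Sec I F E) (i : Fin k) (w : Sec I F E), w x = s i x →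
      g (Function.update s i w) x = g s x := by
    intro s i w hw
    have := key s i (w - s i) (by simp [hw])
    rw [g.map_update_sub, Function.update_eq_self] at this
    exact sub_eq_zero.1 this
  have : ∀ t : Finset (Fin k), g (t.piecewise s' s) x = g s x := by
    intro t
    induction t using Finset.induction_on with
    | empty => simp
    | insert i t hi ih =>
      rw [Finset.piecewise_insert, step _ _ _ (by simp [hi, h]), ih]
  simpa using (this Finset.univ).symm

end Extension

section Forms

/-- A map into `F [⋀^Fin k]→L[ℝ] ℝ`, with `F` finite-dimensional, is smooth as soon as all its
evaluations are. -/
theorem contMDiffAt_alternating [FiniteDimensional ℝ F] {k : ℕ}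
    {A : M → F [⋀^Fin k]→L[ℝ] ℝ} {x : M}
    (hA : ∀ v, ContMDiffAt I 𝓘(ℝ, ℝ) ∞ (fun y => A y v) x) :
    ContMDiffAt I 𝓘(ℝ, F [⋀^Fin k]→L[ℝ] ℝ) ∞ A x := by
  let b := Module.finBasis ℝ F
  let j : (F [⋀^Fin k]→L[ℝ] ℝ) →ₗ[ℝ] ((Fin k → Fin (Module.finrank ℝ F)) → ℝ) :=
    { toFun := fun f m => f fun i => b (m i)
      map_add' := fun _ _ => rfl
      map_smul' := fun _ _ => rfl }
  have hj : LinearMap.ker j = ⊥ := by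
    refine LinearMap.ker_eq_bot.2 fun f g hfg => ?_
    refine ContinuousAlternatingMap.toAlternatingMap_injective ?_
    refine AlternatingMap.coe_multilinearMap_injective ?_
    exact Module.Basis.ext_multilinear (fun _ => b) fun m => congrFun hfg m
  obtain ⟨p, hp⟩ := j.exists_leftInverse_of_injective hj
  have h1 : A = fun y => LinearMap.toContinuousLinearMap p (j (A y)) := by
    ext1 y
    exact (LinearMap.congr_fun hp (A y)).symm
  rw [h1]
  have h2 : ContMDiffAt I 𝓘(ℝ, (Fin k → Fin (Module.finrank ℝ F)) → ℝ) ∞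
      (fun y => j (A y)) x := contMDiffAt_pi_space.2 fun m => hA _
  exact (LinearMap.toContinuousLinearMap p).contMDiff.contMDiffAt.comp x h2

/-- Evaluation of smoothly varying alternating forms at smoothly varying vectors. -/
theorem contMDiffAt_alternating_apply [FiniteDimensional ℝ F] {k : ℕ}
    {A : M → F [⋀^Fin k]→L[ℝ] ℝ} {v : Fin k → M → F} {x : M}
    (hA : ContMDiffAt I 𝓘(ℝ, F [⋀^Fin k]→L[ℝ] ℝ) ∞ A x)
    (hv : ∀ i, ContMDiffAt I 𝓘(ℝ, F) ∞ (v i) x) :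
    ContMDiffAt I 𝓘(ℝ, ℝ) ∞ (fun y => A y fun i => v i y) x := by
  let b := Module.finBasis ℝ F
  have h1 : (fun y => A y fun i => v i y) = fun y =>
      ∑ m : Fin k → Fin (Module.finrank ℝ F), (∏ i, b.repr (v i y) (m i)) *
        A y fun i => b (m i) := by
    ext y
    conv_lhs => enter [2, i]; rw [← b.sum_repr (v i y)]
    change (A y).toMultilinearMap _ = _
    rw [MultilinearMap.map_sum]
    refine Finset.sum_congr rfl fun m _ => ?_
    rw [MultilinearMap.map_smul_univ]
    rfl
  rw [h1]
  refine ContMDiffAt.sum fun m _ => ?_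
  refine ContMDiffAt.mul (contMDiffAt_finsetProd fun i _ => ?_) ?_
  · exact (LinearMap.toContinuousLinearMap (b.coord (m i))).contMDiff.contMDiffAt.comp x (hv i)
  · exact (ContinuousAlternatingMap.apply ℝ F ℝ fun i => b (m i)).contMDiff.contMDiffAt.comp x hA

variable (F) in
/-- An alternating form on a fibre of `E` is continuous. -/
def fiberAlt [FiniteDimensional ℝ F] {k : ℕ} (x : M) (f : E x [⋀^Fin k]→ₗ[ℝ] ℝ) :
    E x [⋀^Fin k]→L[ℝ] Bundle.Trivial M ℝ x :=
  { f with
    cont := by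
      have : T2Space (E x) := FiberBundle.t2Space F E x
      have : FiniteDimensional ℝ (E x) := VectorBundle.finiteDimensional ℝ F E x
      have : IsTopologicalAddGroup (E x) :=
        (VectorBundle.continuousLinearEquivAt ℝ F E x).toContinuousAddEquiv.isTopologicalAddGroup
      have : ContinuousSMul ℝ (E x) :=
        (VectorBundle.continuousLinearEquivAt ℝ F E x).continuousSMul
      let b := Module.finBasis ℝ (E x)
      have h1 : ∀ v : Fin k → E x, f v = ∑ m : Fin k → Fin (Module.finrank ℝ (E x)),
          (∏ i, b.coord (m i) (v i)) * f fun i => b (m i) := by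
        intro v
        conv_lhs => enter [2, i]; rw [← b.sum_repr (v i)]
        change f.toMultilinearMap _ = _
        rw [MultilinearMap.map_sum]
        refine Finset.sum_congr rfl fun m _ => ?_
        rw [MultilinearMap.map_smul_univ]
        rfl
      have h2 : Continuous fun v : Fin k → E x =>
          ∑ m : Fin k → Fin (Module.finrank ℝ (E x)),
            (∏ i, b.coord (m i) (v i)) * f fun i => b (m i) := by
        refine continuous_finsetSum _ fun m _ => ?_
        refine Continuous.mul (continuous_finsetProd _ fun i _ => ?_) continuous_const
        exact (LinearMap.continuous_of_finiteDimensional (b.coord (m i))).comp (continuous_apply i)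
      exact h2.congr fun v => (h1 v).symm }

variable (I F E) in
/-- `Γ(Λᵏ E*)`: the smooth sections of the bundle of alternating `k`-forms on the fibres of `E`. -/
abbrev Form (k : ℕ) : Type _ :=
  Sec I (F [⋀^Fin k]→L[ℝ] ℝ) (fun x => E x [⋀^Fin k]→L[ℝ] Bundle.Trivial M ℝ x)

theorem contMDiffAt_form_iff {k : ℕ} (α : ∀ x, E x [⋀^Fin k]→L[ℝ] Bundle.Trivial M ℝ x) (x : M) :
    ContMDiffAt I (I.prod 𝓘(ℝ, F [⋀^Fin k]→L[ℝ] ℝ)) ∞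
      (fun y => TotalSpace.mk' (F [⋀^Fin k]→L[ℝ] ℝ) y (α y)) x ↔
    ContMDiffAt I 𝓘(ℝ, F [⋀^Fin k]→L[ℝ] ℝ) ∞
      (fun y => ContinuousAlternatingMap.compContinuousLinearMap (N := ℝ) (α y)
        ((trivializationAt F E x).symmL ℝ y)) x := by
  refine (contMDiffAt_section (IB := I) (n := ∞) x).trans (iff_of_eq ?_)
  congr 1
  ext y v
  change (Bundle.Trivial.trivialization M ℝ).continuousLinearMapAt ℝ y
    (α y fun i => (trivializationAt F E x).symmL ℝ y (v i)) = _
  rw [Bundle.Trivial.continuousLinearMapAt_trivialization]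
  rfl

namespace Form

variable {k : ℕ} [FiniteDimensional ℝ F]

/-- The smooth function `α(s₁, …, sₖ)`. -/
def ev (α : Form I F E k) (s : Fin k → Sec I F E) : SmoothFn I M :=
  ⟨fun x => (α x fun i => s i x : ℝ), fun x => by
    have h1 := contMDiffAt_alternating_apply ((contMDiffAt_form_iff _ x).1 (α.contMDiff x))
      fun i => (contMDiffAt_section (IB := I) (n := ∞) x).1 ((s i).contMDiff x)
    refine h1.congr_of_eventuallyEq ?_
    let e := trivializationAt F E x
    filter_upwards [e.open_baseSet.mem_nhds (FiberBundle.mem_baseSet_trivializationAt F E x)]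
      with y hy
    have h2 : ∀ i, e.symmL ℝ y (e ⟨y, s i y⟩).2 = s i y := fun i =>
      (e.symmL_apply hy _).trans (e.symm_apply_apply_mk hy (s i y))
    change (α y fun i => s i y) = α y fun i => e.symmL ℝ y (e ⟨y, s i y⟩).2
    simp_rw [h2]⟩

/-- A form, as an alternating `C^∞(M)`-multilinear map on sections. -/
def toAlt (α : Form I F E k) : Sec I F E [⋀^Fin k]→ₗ[SmoothFn I M] SmoothFn I M where
  toFun := α.ev
  map_update_add' s i a b := by
    ext x
    have (c : Sec I F E) : (fun j => Function.update s i c j x) =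
        Function.update (fun j => s j x) i (c x) := by
      ext j; by_cases h : j = i
      · subst h; simp
      · simp [h]
    change α x _ = α x _ + α x _
    simp only [this]
    exact (α x).map_update_add ..
  map_update_smul' s i f a := by
    ext x
    have (c : Sec I F E) : (fun j => Function.update s i c j x) =
        Function.update (fun j => s j x) i (c x) := by
      ext j; by_cases h : j = i
      · subst h; simp
      · simp [h]
    change α x _ = f x * α x _
    simp only [this]
    exact (α x).map_update_smul ..
  map_eq_zero_of_eq' s i j h hij := by
    ext x
    exact (α x).map_eq_zero_of_eq _ (by simp [h]) hij

variable [FiniteDimensional ℝ EM] [T2Space M] [IsManifold I ∞ M] [ContMDiffVectorBundle ∞ F E I]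

theorem ext_ev {α β : Form I F E k} (h : ∀ s, α.ev s = β.ev s) : α = β := by
  ext x v
  have h2 := congrArg (fun f : SmoothFn I M => f x) (h fun i => extendSec x (v i))
  have h3 : (α x fun i => (extendSec x (v i) : Sec I F E) x) =
    β x fun i => (extendSec x (v i) : Sec I F E) x := h2
  simpa using h3

/-- The form defined by an alternating `C^∞(M)`-multilinear map on sections. -/
def ofAlt (g : Sec I F E [⋀^Fin k]→ₗ[SmoothFn I M] SmoothFn I M) : Form I F E k :=
  ⟨fun x => fiberAlt F x
    { toFun := fun v => g (fun i => extendSec x (v i)) x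
      map_update_add' := by
        intro _ v i a b
        have (c : E x) : (fun j => (extendSec x (Function.update v i c j) : Sec I F E)) =
            Function.update (fun j => extendSec x (v j)) i (extendSec x c) := by
          ext j : 1; by_cases h : j = i
          · subst h; simp
          · simp [h]
        simp only [this, map_add, AlternatingMap.map_update_add]
        rfl
      map_update_smul' := by
        intro _ v i a b
        have (c : E x) : (fun j => (extendSec x (Function.update v i c j) : Sec I F E)) =
            Function.update (fun j => extendSec x (v j)) i (extendSec x c) := by
          ext j : 1; by_cases h : j = i
          · subst h; simp
          · simp [h]
        have h2 : (extendSec x (a • b) : Sec I F E) =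
            (algebraMap ℝ (SmoothFn I M) a) • extendSec x b := by
          rw [map_smul]; rfl
        simp only [this, h2, AlternatingMap.map_update_smul]
        rfl
      map_eq_zero_of_eq' := fun v i j h hij => by
        rw [g.map_eq_zero_of_eq _ (by simp [h]) hij]; rfl },
    fun x => by
      refine (contMDiffAt_form_iff _ x).2 (contMDiffAt_alternating fun v => ?_)
      choose u hu using fun w => exists_sec_eventuallyEq (I := I) (F := F) (E := E) x w
      refine (g fun i => u (v i)).contMDiff.contMDiffAt.congr_of_eventuallyEq ?_
      have h3 : ∀ᶠ y in 𝓝 x, ∀ i,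
          u (v i) y = (trivializationAt F E x).symmL ℝ y (v i) :=
        Filter.eventually_all.2 fun i => hu (v i)
      filter_upwards [h3] with y hy
      refine alt_congr_at g y _ _ fun i => ?_
      rw [extendSec_apply, hy]
      rfl⟩

@[simp] theorem ev_ofAlt (g : Sec I F E [⋀^Fin k]→ₗ[SmoothFn I M] SmoothFn I M)
    (s : Fin k → Sec I F E) : (ofAlt g).ev s = g s := by
  ext x
  exact alt_congr_at g x _ _ fun i => by rw [extendSec_apply]

end Form

end Forms

section Courant

variable (I F E) in
/-- A fibre metric: a smooth nondegenerate symmetric bilinear form on the fibres of `E`. -/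
structure FiberMetric where
  toFun : ∀ x, E x →ₗ[ℝ] E x →ₗ[ℝ] ℝ
  symm' : ∀ x v w, toFun x v w = toFun x w v
  nondegenerate' : ∀ x v, (∀ w, toFun x v w = 0) → v = 0
  contMDiff' : ∀ s t : Sec I F E, ContMDiff I 𝓘(ℝ, ℝ) ∞ fun x => toFun x (s x) (t x)

namespace FiberMetric

/-- The smooth function `h(s, t)`. -/
def pair (h : FiberMetric I F E) (s t : Sec I F E) : SmoothFn I M :=
  ⟨fun x => h.toFun x (s x) (t x), h.contMDiff' s t⟩

variable (h : FiberMetric I F E)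

theorem pair_comm (s t : Sec I F E) : h.pair s t = h.pair t s := by
  ext x; exact h.symm' x _ _

theorem pair_add_left (s t u : Sec I F E) : h.pair (s + t) u = h.pair s u + h.pair t u := by
  ext x
  change h.toFun x (s x + t x) _ = h.toFun x (s x) _ + h.toFun x (t x) _
  simp

theorem pair_smul_left (f : SmoothFn I M) (s u : Sec I F E) :
    h.pair (f • s) u = f * h.pair s u := by
  ext x
  change h.toFun x (f x • s x) _ = f x * h.toFun x (s x) _
  simp

theorem pair_add_right (s t u : Sec I F E) : h.pair u (s + t) = h.pair u s + h.pair u t := by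
  rw [h.pair_comm, pair_add_left, h.pair_comm s, h.pair_comm t]

theorem pair_smul_right (f : SmoothFn I M) (s u : Sec I F E) :
    h.pair u (f • s) = f * h.pair u s := by
  rw [h.pair_comm, pair_smul_left, h.pair_comm s]

theorem pair_ext [FiniteDimensional ℝ EM] [T2Space M] [IsManifold I ∞ M]
    [FiniteDimensional ℝ F] [ContMDiffVectorBundle ∞ F E I] {s t : Sec I F E}
    (hst : ∀ u, h.pair s u = h.pair t u) : s = t := by
  ext x
  refine sub_eq_zero.1 (h.nondegenerate' x _ fun w => ?_)
  have := congrArg (fun f : SmoothFn I M => f x) (hst (extendSec x w))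
  have h2 : h.toFun x (s x) ((extendSec x w : Sec I F E) x) =
    h.toFun x (t x) ((extendSec x w : Sec I F E) x) := this
  rw [extendSec_apply] at h2
  simp [h2]

end FiberMetric

variable [IsManifold I ∞ M]

variable (I F E) in
/-- A smooth vector bundle homomorphism `ρ : E → TM` over the identity of `M`. -/
structure Anchor where
  toFun : ∀ x, E x →ₗ[ℝ] TangentSpace I x
  contMDiff' : ∀ s : Sec I F E,
    ContMDiff I I.tangent ∞ fun x => (⟨x, toFun x (s x)⟩ : TangentBundle I M)

namespace Anchor

/-- The derivative `ρ(s) f` of a function `f` along the vector field `ρ(s)`. -/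
def deriv (r : Anchor I F E) (s : Sec I F E) (f : SmoothFn I M) : SmoothFn I M :=
  ⟨fun x => (mfderiv I 𝓘(ℝ, ℝ) f x (r.toFun x (s x)) : ℝ), by
    have h1 : ContMDiff I.tangent 𝓘(ℝ, ℝ).tangent ∞ (tangentMap I 𝓘(ℝ, ℝ) f) :=
      f.contMDiff.contMDiff_tangentMap (by simp)
    exact (contMDiff_snd_tangentBundle_modelSpace ℝ 𝓘(ℝ, ℝ)).comp (h1.comp (r.contMDiff' s))⟩

variable (r : Anchor I F E)

theorem deriv_apply (s : Sec I F E) (f : SmoothFn I M) (x : M) :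
    r.deriv s f x = (mfderiv I 𝓘(ℝ, ℝ) f x (r.toFun x (s x)) : ℝ) := rfl

theorem deriv_add_left (s t : Sec I F E) (f : SmoothFn I M) :
    r.deriv (s + t) f = r.deriv s f + r.deriv t f := by
  ext x
  change (mfderiv I 𝓘(ℝ, ℝ) f x (r.toFun x (s x + t x)) : ℝ) = r.deriv s f x + r.deriv t f x
  rw [map_add, map_add]; rfl

theorem deriv_smul_left (g : SmoothFn I M) (s : Sec I F E) (f : SmoothFn I M) :
    r.deriv (g • s) f = g * r.deriv s f := by
  ext x
  change (mfderiv I 𝓘(ℝ, ℝ) f x (r.toFun x (g x • s x)) : ℝ) = g x * r.deriv s f x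
  rw [map_smul, map_smul]; rfl

theorem deriv_add (s : Sec I F E) (f g : SmoothFn I M) :
    r.deriv s (f + g) = r.deriv s f + r.deriv s g := by
  ext x
  have := mfderiv_add (I := I) (f := f) (g := g) (z := x) f.mdifferentiableAt g.mdifferentiableAt
  change (mfderiv I 𝓘(ℝ, ℝ) (⇑f + ⇑g) x (r.toFun x (s x)) : ℝ) = _
  rw [this]; rfl

theorem deriv_mul (s : Sec I F E) (f g : SmoothFn I M) :
    r.deriv s (f * g) = f * r.deriv s g + g * r.deriv s f := by
  ext x
  have := ((f.mdifferentiableAt (x := x)).hasMFDerivAt.mul g.mdifferentiableAt.hasMFDerivAt).mfderiv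
  change (mfderiv I 𝓘(ℝ, ℝ) (⇑f * ⇑g) x (r.toFun x (s x)) : ℝ) = _
  rw [this]; rfl

theorem deriv_const (s : Sec I F E) (c : ℝ) :
    r.deriv s (algebraMap ℝ (SmoothFn I M) c) = 0 := by
  ext x
  change (mfderiv I 𝓘(ℝ, ℝ) (fun _ => c) x (r.toFun x (s x)) : ℝ) = _
  rw [mfderiv_const]; rfl

end Anchor

/-- A Courant algebroid structure on the vector bundle `E` with fibre metric `h`. In the second
axiom, `𝒟 : C^∞(M) → Γ(E)` is determined by `h(𝒟 f, e) = ρ(e) f`. -/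
structure CourantAlgebroid (h : FiberMetric I F E) where
  anchor : Anchor I F E
  bracket : Sec I F E → Sec I F E → Sec I F E
  jacobi : ∀ a b c, bracket a (bracket b c) = bracket (bracket a b) c + bracket b (bracket a c)
  symm_part : ∀ a b e, h.pair (bracket a b + bracket b a) e = anchor.deriv e (h.pair a b)
  metric_compat : ∀ a b c,
    anchor.deriv a (h.pair b c) = h.pair (bracket a b) c + h.pair b (bracket a c)

/-- A Dirac structure: a smooth subbundle `D ⊆ E` that is maximally isotropic and whose sections
are closed under the Courant bracket. -/
structure CourantAlgebroid.IsDirac {h : FiberMetric I F E} (C : CourantAlgebroid h)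
    (D : ∀ x, Submodule ℝ (E x)) : Prop where
  subbundle : ∀ x, ∃ (n : ℕ) (u : Fin n → Sec I F E), ∀ᶠ y in 𝓝 x,
    LinearIndependent ℝ (fun i => u i y) ∧ Submodule.span ℝ (Set.range fun i => u i y) = D y
  isotropic : ∀ x, ∀ v ∈ D x, ∀ w ∈ D x, h.toFun x v w = 0
  maximal : ∀ x (W : Submodule ℝ (E x)), (∀ v ∈ W, ∀ w ∈ W, h.toFun x v w = 0) →
    D x ≤ W → W = D x
  closed : ∀ a b : Sec I F E, (∀ x, a x ∈ D x) → (∀ x, b x ∈ D x) →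
    ∀ x, C.bracket a b x ∈ D x

namespace CourantAlgebroid

variable {h : FiberMetric I F E} (C : CourantAlgebroid h)
  [FiniteDimensional ℝ EM] [T2Space M] [FiniteDimensional ℝ F] [ContMDiffVectorBundle ∞ F E I]

theorem bracket_add_right (a b c : Sec I F E) :
    C.bracket a (b + c) = C.bracket a b + C.bracket a c := by
  refine h.pair_ext fun u => ?_
  have h1 := C.metric_compat a (b + c) u
  have h2 := C.metric_compat a b u
  have h3 := C.metric_compat a c u
  simp only [h.pair_add_left, C.anchor.deriv_add] at h1 ⊢
  linear_combination h2 + h3 - h1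

theorem bracket_smul_right (a b : Sec I F E) (f : SmoothFn I M) :
    C.bracket a (f • b) = f • C.bracket a b + C.anchor.deriv a f • b := by
  refine h.pair_ext fun u => ?_
  have h1 := C.metric_compat a (f • b) u
  have h2 := C.metric_compat a b u
  simp only [h.pair_add_left, h.pair_smul_left, C.anchor.deriv_mul] at h1 ⊢
  linear_combination f * h2 - h1

theorem bracket_swap (a b u : Sec I F E) :
    h.pair (C.bracket a b) u = C.anchor.deriv u (h.pair a b) - h.pair (C.bracket b a) u := by
  have := C.symm_part a b u
  rw [h.pair_add_left] at this
  linear_combination this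

theorem bracket_add_left (a b c : Sec I F E) :
    C.bracket (a + b) c = C.bracket a c + C.bracket b c := by
  refine h.pair_ext fun u => ?_
  rw [h.pair_add_left, C.bracket_swap, C.bracket_swap a, C.bracket_swap b, C.bracket_add_right,
    h.pair_add_left, h.pair_add_left, C.anchor.deriv_add]
  ring

theorem pair_bracket_smul_left (a b u : Sec I F E) (f : SmoothFn I M) :
    h.pair (C.bracket (f • a) b) u = f * h.pair (C.bracket a b) u -
      C.anchor.deriv b f * h.pair a u + C.anchor.deriv u f * h.pair a b := by
  rw [C.bracket_swap, C.bracket_swap a, C.bracket_smul_right, h.pair_smul_left,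
    C.anchor.deriv_mul, h.pair_add_left, h.pair_smul_left, h.pair_smul_left]
  ring

end CourantAlgebroid

end Courant

end General

section Double

variable {EM : Type*} [NormedAddCommGroup EM] [NormedSpace ℝ EM]
  {HM : Type*} [TopologicalSpace HM] (I : ModelWithCorners ℝ EM HM)
  {M : Type*} [TopologicalSpace M] [ChartedSpace HM M]
  (F : Type*) [NormedAddCommGroup F] [NormedSpace ℝ F]
  (L : M → Type*) [TopologicalSpace (TotalSpace F L)]
  [∀ x, AddCommGroup (L x)] [∀ x, Module ℝ (L x)] [∀ x, TopologicalSpace (L x)]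
  [FiberBundle F L] [VectorBundle ℝ F L]

/-- The dual bundle `L*`. -/
abbrev DualBundle (x : M) : Type _ := L x →L[ℝ] Bundle.Trivial M ℝ x

/-- The bundle `L ⊕ L*`. -/
abbrev Double (x : M) : Type _ := L x × DualBundle L x

/-- The model fibre of `L*`. -/
abbrev DualFiber : Type _ := F →L[ℝ] ℝ

/-- The model fibre of `L ⊕ L*`. -/
abbrev DoubleFiber : Type _ := F × DualFiber F

variable {I F L}

/-- The section `s + σ` of `L ⊕ L*`. -/
def mkSec (s : Sec I F L) (σ : Sec I (DualFiber F) (DualBundle L)) :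
    Sec I (DoubleFiber F) (Double L) :=
  ⟨fun x => (s x, σ x), fun x => by
    have h1 := (contMDiffAt_section (IB := I) (n := ∞) x).1 (s.contMDiff x)
    have h2 := (contMDiffAt_section (IB := I) (n := ∞) x).1 (σ.contMDiff x)
    exact (contMDiffAt_section (IB := I) (n := ∞) x).2 (h1.prodMk_space h2)⟩

/-- The projection `Γ(L ⊕ L*) → Γ(L)`. -/
def prL (e : Sec I (DoubleFiber F) (Double L)) : Sec I F L :=
  ⟨fun x => (e x).1, fun x => by
    have h1 := (contMDiffAt_section (IB := I) (n := ∞) x).1 (e.contMDiff x)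
    exact (contMDiffAt_section (IB := I) (n := ∞) x).2
      ((ContinuousLinearMap.fst ℝ F (DualFiber F)).contMDiff.contMDiffAt.comp x h1)⟩

/-- The projection `Γ(L ⊕ L*) → Γ(L*)`. -/
def prDual (e : Sec I (DoubleFiber F) (Double L)) : Sec I (DualFiber F) (DualBundle L) :=
  ⟨fun x => (e x).2, fun x => by
    have h1 := (contMDiffAt_section (IB := I) (n := ∞) x).1 (e.contMDiff x)
    exact (contMDiffAt_section (IB := I) (n := ∞) x).2
      ((ContinuousLinearMap.snd ℝ F (DualFiber F)).contMDiff.contMDiffAt.comp x h1)⟩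

/-- The smooth function `σ(s)` for `σ ∈ Γ(L*)` and `s ∈ Γ(L)`. -/
def ap (σ : Sec I (DualFiber F) (DualBundle L)) (s : Sec I F L) : SmoothFn I M :=
  ⟨fun x => σ x (s x), fun x => by
    have h1 := (σ.contMDiff x).clm_bundle_apply (s.contMDiff x)
    simpa using! (contMDiffAt_section (IB := I) (F := ℝ) (E := Bundle.Trivial M ℝ) (n := ∞) x).1 h1⟩

section dualSec
variable [FiniteDimensional ℝ EM] [T2Space M] [IsManifold I ∞ M]
  [FiniteDimensional ℝ F] [ContMDiffVectorBundle ∞ F L I]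

variable (F) in
/-- A linear functional on a fibre of `L` is continuous. -/
def fiberDual (x : M) (f : L x →ₗ[ℝ] ℝ) : DualBundle L x :=
  have : T2Space (L x) := FiberBundle.t2Space F L x
  have : FiniteDimensional ℝ (L x) := VectorBundle.finiteDimensional ℝ F L x
  have : IsTopologicalAddGroup (L x) :=
    (VectorBundle.continuousLinearEquivAt ℝ F L x).toContinuousAddEquiv.isTopologicalAddGroup
  have (x : M) : ContinuousSMul ℝ (L x) :=
    (VectorBundle.continuousLinearEquivAt ℝ F L x).continuousSMul
  LinearMap.toContinuousLinearMap f

@[simp] theorem fiberDual_apply (x : M) (f : L x →ₗ[ℝ] ℝ) (v : L x) :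
    fiberDual F x f v = f v := rfl

/-- The section of `L*` given by a family of functionals on the fibres that is smooth on smooth
sections. -/
def dualSec (f : ∀ x, L x →ₗ[ℝ] ℝ)
    (hf : ∀ s : Sec I F L, ContMDiff I 𝓘(ℝ, ℝ) ∞ fun x => f x (s x)) :
    Sec I (DualFiber F) (DualBundle L) :=
  ⟨fun x => fiberDual F x (f x), fun x => by
    rw [contMDiffAt_section]
    let b := Module.finBasis ℝ F
    choose u hu using fun w => exists_sec_eventuallyEq (I := I) (F := F) (E := L) x w
    have h1 : ContMDiffAt I 𝓘(ℝ, F →L[ℝ] ℝ) ∞ (fun y => ∑ i, f y (u (b i) y) •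
        (LinearMap.toContinuousLinearMap (b.coord i) : F →L[ℝ] ℝ)) x :=
      ContMDiffAt.sum fun i _ => (hf (u (b i)) x).smul contMDiffAt_const
    refine h1.congr_of_eventuallyEq ?_
    filter_upwards [Filter.eventually_all.2 fun i => hu (b i)] with y hy
    refine ContinuousLinearMap.coe_injective (b.ext fun j => ?_)
    change (Bundle.Trivial.trivialization M ℝ).continuousLinearMapAt ℝ y
      (f y ((trivializationAt F L x).symmL ℝ y (b j))) = _
    rw [Bundle.Trivial.continuousLinearMapAt_trivialization]
    simp only [hy, ContinuousLinearMap.coe_coe, sum_apply,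
      smul_apply, LinearMap.coe_toContinuousLinearMap', Module.Basis.coord_apply,
      Module.Basis.repr_self, ContinuousLinearMap.id_apply]
    rw [Finset.sum_eq_single j]
    · simp
    · intro i _ hij
      simp [hij.symm]
    · simp⟩

@[simp] theorem ap_dualSec (f : ∀ x, L x →ₗ[ℝ] ℝ)
    (hf : ∀ s : Sec I F L, ContMDiff I 𝓘(ℝ, ℝ) ∞ fun x => f x (s x)) (s : Sec I F L) (x : M) :
    ap (dualSec f hf) s x = f x (s x) := rfl

/-- The map `α : Γ(L) → Γ(L*)`, `α(s) = α(s, ·)`, of a two-form `α`. -/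
def flat (α : Form I F L 2) (s : Sec I F L) : Sec I (DualFiber F) (DualBundle L) :=
  dualSec (fun x =>
    { toFun := fun w => (α x ![s x, w] : ℝ)
      map_add' := fun v w => by
        have h (c : L x) : ![s x, c] = Function.update ![s x, 0] 1 c :=
          vec2_eq_update _ _ _
        change (α x ![s x, v + w] : ℝ) = α x ![s x, v] + α x ![s x, w]
        rw [h (v + w), h v, h w]
        exact (α x).map_update_add ![s x, 0] 1 v w
      map_smul' := fun c w => by
        have h (c : L x) : ![s x, c] = Function.update ![s x, 0] 1 c :=
          vec2_eq_update _ _ _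
        change (α x ![s x, c • w] : ℝ) = c • (α x ![s x, w] : ℝ)
        rw [h (c • w), h w]
        exact (α x).map_update_smul ![s x, 0] 1 c w })
    fun t => (α.ev ![s, t]).contMDiff.congr fun x => by
      change (α x ![s x, t x] : ℝ) = α x fun i => ![s, t] i x
      congr 1
      ext i
      fin_cases i <;> rfl

theorem ap_flat (α : Form I F L 2) (s t : Sec I F L) : ap (flat α s) t = α.ev ![s, t] := by
  ext x
  change (α x ![s x, t x] : ℝ) = α x fun i => ![s, t] i x
  congr 1
  ext i
  fin_cases i <;> rfl

end dualSec

/-- The natural pairing `⟨s + σ, t + τ⟩ = σ(t) + τ(s)` on `L ⊕ L*`. -/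
def naturalPairing [FiniteDimensional ℝ F] :
    FiberMetric I (DoubleFiber F) (Double L) where
  toFun x := LinearMap.mk₂ ℝ (fun v w => (v.2 w.1 + w.2 v.1 : ℝ))
    (fun v v' w => by
      change (v.2 w.1 + v'.2 w.1 + w.2 (v.1 + v'.1) : ℝ) =
        v.2 w.1 + w.2 v.1 + (v'.2 w.1 + w.2 v'.1)
      rw [map_add]; exact add_add_add_comm _ _ _ _)
    (fun c v w => by
      change (c * v.2 w.1 + w.2 (c • v.1) : ℝ) = c * (v.2 w.1 + w.2 v.1)
      rw [map_smul]; exact (mul_add _ _ _).symm)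
    (fun v w w' => by
      change (v.2 (w.1 + w'.1) + (w.2 v.1 + w'.2 v.1) : ℝ) =
        v.2 w.1 + w.2 v.1 + (v.2 w'.1 + w'.2 v.1)
      rw [map_add]; exact add_add_add_comm _ _ _ _)
    (fun c v w => by
      change (v.2 (c • w.1) + c * w.2 v.1 : ℝ) = c * (v.2 w.1 + w.2 v.1)
      rw [map_smul]; exact (mul_add _ _ _).symm)
  symm' _ _ _ := add_comm _ _
  nondegenerate' x v hv := by
    have h1 : v.2 = 0 := by
      ext w
      have h : (v.2 w + (0 : DualBundle L x) v.1 : ℝ) = 0 := hv (w, 0)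
      simpa using! h
    have h2 : v.1 = 0 := by
      have : FiniteDimensional ℝ (L x) := VectorBundle.finiteDimensional ℝ F L x
      refine (Module.forall_dual_apply_eq_zero_iff ℝ v.1).1 fun f => ?_
      have h : (v.2 0 + f v.1 : ℝ) = 0 := hv (0, fiberDual F x f)
      rwa [map_zero, zero_add] at h
    exact Prod.ext h2 h1
  contMDiff' s t := ((ap (prDual s) (prL t)) + (ap (prDual t) (prL s))).contMDiff

theorem pair_eq [FiniteDimensional ℝ F] (e e' : Sec I (DoubleFiber F) (Double L)) :
    naturalPairing.pair e e' = ap (prDual e) (prL e') + ap (prDual e') (prL e) := rfl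

/-- The inclusion `Γ(L) ⊆ Γ(L ⊕ L*)`. -/
def inL (s : Sec I F L) : Sec I (DoubleFiber F) (Double L) := mkSec s 0

/-- The inclusion `Γ(L*) ⊆ Γ(L ⊕ L*)`. -/
def inDual (σ : Sec I (DualFiber F) (DualBundle L)) : Sec I (DoubleFiber F) (Double L) :=
  mkSec 0 σ

variable (L) in
/-- The subbundle `L ⊆ L ⊕ L*`. -/
def summandL (x : M) : Submodule ℝ (Double L x) :=
  LinearMap.ker (LinearMap.snd ℝ (L x) (DualBundle L x))

theorem prL_add (e e' : Sec I (DoubleFiber F) (Double L)) : prL (e + e') = prL e + prL e' := rfl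
theorem prL_smul (f : SmoothFn I M) (e : Sec I (DoubleFiber F) (Double L)) :
    prL (f • e) = f • prL e := rfl
theorem prDual_add (e e' : Sec I (DoubleFiber F) (Double L)) :
    prDual (e + e') = prDual e + prDual e' := rfl
theorem prDual_smul (f : SmoothFn I M) (e : Sec I (DoubleFiber F) (Double L)) :
    prDual (f • e) = f • prDual e := rfl
theorem inL_add (s t : Sec I F L) : inL (s + t) = inL s + inL t :=
  ContMDiffSection.ext fun _ => Prod.ext rfl (add_zero _).symm
theorem inL_smul (f : SmoothFn I M) (s : Sec I F L) : inL (f • s) = f • inL s :=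
  ContMDiffSection.ext fun _ => Prod.ext rfl (smul_zero _).symm
theorem inDual_add (s t : Sec I (DualFiber F) (DualBundle L)) :
    inDual (s + t) = inDual s + inDual t :=
  ContMDiffSection.ext fun _ => Prod.ext (add_zero _).symm rfl
theorem inDual_smul (f : SmoothFn I M) (s : Sec I (DualFiber F) (DualBundle L)) :
    inDual (f • s) = f • inDual s :=
  ContMDiffSection.ext fun _ => Prod.ext (smul_zero _).symm rfl
theorem ap_add_left (σ τ : Sec I (DualFiber F) (DualBundle L)) (s : Sec I F L) :
    ap (σ + τ) s = ap σ s + ap τ s := rfl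
theorem ap_smul_left (f : SmoothFn I M) (σ : Sec I (DualFiber F) (DualBundle L)) (s : Sec I F L) :
    ap (f • σ) s = f * ap σ s := rfl
theorem ap_add_right (σ : Sec I (DualFiber F) (DualBundle L)) (s t : Sec I F L) :
    ap σ (s + t) = ap σ s + ap σ t := by
  ext x; exact (σ x).map_add _ _
theorem ap_smul_right (f : SmoothFn I M) (σ : Sec I (DualFiber F) (DualBundle L))
    (s : Sec I F L) : ap σ (f • s) = f * ap σ s := by
  ext x; exact (σ x).map_smul _ _
theorem ap_zero_left (s : Sec I F L) : ap (0 : Sec I (DualFiber F) (DualBundle L)) s = 0 := rfl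
theorem ap_zero_right (σ : Sec I (DualFiber F) (DualBundle L)) : ap σ (0 : Sec I F L) = 0 := by
  ext x; exact (σ x).map_zero
theorem ap_neg_left (σ : Sec I (DualFiber F) (DualBundle L)) (s : Sec I F L) :
    ap (-σ) s = -ap σ s := rfl
@[simp] theorem prL_inL (s : Sec I F L) : prL (inL s) = s := rfl
@[simp] theorem prDual_inL (s : Sec I F L) : prDual (inL s) = 0 := rfl
@[simp] theorem prL_inDual (s : Sec I (DualFiber F) (DualBundle L)) : prL (inDual s) = 0 := rfl
@[simp] theorem prDual_inDual (s : Sec I (DualFiber F) (DualBundle L)) :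
    prDual (inDual s) = s := rfl

namespace CourantAlgebroid

section Components

variable [IsManifold I ∞ M] [FiniteDimensional ℝ F] [ContMDiffVectorBundle ∞ F L I]
  (C : CourantAlgebroid (naturalPairing (I := I) (F := F) (L := L)))

/-- The bracket `pr_L [s, t]` on `Γ(L)`. -/
def brL (s t : Sec I F L) : Sec I F L := prL (C.bracket (inL s) (inL t))

/-- The anchor `ρ|_L`, acting on functions. -/
def rhoL (s : Sec I F L) (f : SmoothFn I M) : SmoothFn I M := C.anchor.deriv (inL s) f

/-- The bracket `[σ, τ]_{L*} = pr_{L*} [σ, τ]` on `Γ(L*)`. -/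
def brDual (σ τ : Sec I (DualFiber F) (DualBundle L)) : Sec I (DualFiber F) (DualBundle L) :=
  prDual (C.bracket (inDual σ) (inDual τ))

/-- The anchor `ρ|_{L*}`, acting on functions. -/
def rhoDual (σ : Sec I (DualFiber F) (DualBundle L)) (f : SmoothFn I M) : SmoothFn I M :=
  C.anchor.deriv (inDual σ) f

/-- The tensor `φ(σ, τ, υ) = -⟨[σ, τ], υ⟩` on `L*`. -/
def phi (σ τ υ : Sec I (DualFiber F) (DualBundle L)) : SmoothFn I M :=
  -naturalPairing.pair (C.bracket (inDual σ) (inDual τ)) (inDual υ)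

theorem pair_inL (s t : Sec I F L) :
    (naturalPairing (I := I) (F := F) (L := L)).pair (inL s) (inL t) = 0 := by
  rw [pair_eq]; simp [ap_zero_left]

theorem pair_inDual (σ τ : Sec I (DualFiber F) (DualBundle L)) :
    (naturalPairing (I := I) (F := F) (L := L)).pair (inDual σ) (inDual τ) = 0 := by
  rw [pair_eq]; simp [ap_zero_right]

theorem deriv_zero (e : Sec I (DoubleFiber F) (Double L)) : C.anchor.deriv e 0 = 0 := by
  simpa using C.anchor.deriv_const e 0

theorem deriv_neg (e : Sec I (DoubleFiber F) (Double L)) (f : SmoothFn I M) :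
    C.anchor.deriv e (-f) = -C.anchor.deriv e f := by
  have h := C.anchor.deriv_add e f (-f)
  rw [add_neg_cancel, C.deriv_zero] at h
  linear_combination -h

variable [FiniteDimensional ℝ EM] [T2Space M]

theorem bracket_skew {e e' : Sec I (DoubleFiber F) (Double L)}
    (h0 : (naturalPairing (I := I) (F := F) (L := L)).pair e e' = 0) :
    C.bracket e' e = -C.bracket e e' := by
  refine eq_neg_of_add_eq_zero_right (naturalPairing.pair_ext fun u => ?_)
  rw [C.symm_part, h0, C.deriv_zero]
  ext x
  change (0 : ℝ) = (naturalPairing (I := I) (F := F) (L := L)).toFun x 0 (u x)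
  rw [map_zero]
  rfl

theorem brL_add_right (s t u : Sec I F L) : C.brL s (t + u) = C.brL s t + C.brL s u := by
  rw [brL, inL_add, C.bracket_add_right, prL_add]; rfl

theorem brL_smul_right (s t : Sec I F L) (f : SmoothFn I M) :
    C.brL s (f • t) = f • C.brL s t + C.rhoL s f • t := by
  rw [brL, inL_smul, C.bracket_smul_right, prL_add, prL_smul, prL_smul]; rfl

theorem brL_skew (s t : Sec I F L) : C.brL t s = -C.brL s t := by
  rw [brL, C.bracket_skew (pair_inL s t)]; rfl

theorem brL_add_left (s t u : Sec I F L) : C.brL (s + t) u = C.brL s u + C.brL t u := by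
  rw [C.brL_skew u, C.brL_skew u, C.brL_skew u, C.brL_add_right, neg_add]

theorem brL_smul_left (s t : Sec I F L) (f : SmoothFn I M) :
    C.brL (f • s) t = f • C.brL s t + (-C.rhoL t f) • s := by
  rw [C.brL_skew t, C.brL_skew t, C.brL_smul_right, neg_add, smul_neg, neg_smul]

theorem brDual_add_right (σ τ υ : Sec I (DualFiber F) (DualBundle L)) :
    C.brDual σ (τ + υ) = C.brDual σ τ + C.brDual σ υ := by
  rw [brDual, inDual_add, C.bracket_add_right, prDual_add]; rfl

theorem brDual_smul_right (σ τ : Sec I (DualFiber F) (DualBundle L)) (f : SmoothFn I M) :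
    C.brDual σ (f • τ) = f • C.brDual σ τ + C.rhoDual σ f • τ := by
  rw [brDual, inDual_smul, C.bracket_smul_right, prDual_add, prDual_smul, prDual_smul]; rfl

theorem brDual_skew (σ τ : Sec I (DualFiber F) (DualBundle L)) :
    C.brDual τ σ = -C.brDual σ τ := by
  rw [brDual, C.bracket_skew (pair_inDual σ τ)]; rfl

theorem brDual_add_left (σ τ υ : Sec I (DualFiber F) (DualBundle L)) :
    C.brDual (σ + τ) υ = C.brDual σ υ + C.brDual τ υ := by
  rw [C.brDual_skew υ, C.brDual_skew υ, C.brDual_skew υ, C.brDual_add_right, neg_add]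

theorem brDual_smul_left (σ τ : Sec I (DualFiber F) (DualBundle L)) (f : SmoothFn I M) :
    C.brDual (f • σ) τ = f • C.brDual σ τ + (-C.rhoDual τ f) • σ := by
  rw [C.brDual_skew τ, C.brDual_skew τ, C.brDual_smul_right]
  ext x : 1
  simp only [negSec_apply, addSec_apply, smulSec_apply]
  change -(f x • C.brDual τ σ x + C.rhoDual τ f x • σ x) =
    f x • -C.brDual τ σ x + (-C.rhoDual τ f x) • σ x
  module

theorem rhoL_add_left (s t : Sec I F L) (f : SmoothFn I M) :
    C.rhoL (s + t) f = C.rhoL s f + C.rhoL t f := by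
  rw [rhoL, inL_add, C.anchor.deriv_add_left]; rfl
theorem rhoL_smul_left (g : SmoothFn I M) (s : Sec I F L) (f : SmoothFn I M) :
    C.rhoL (g • s) f = g * C.rhoL s f := by
  rw [rhoL, inL_smul, C.anchor.deriv_smul_left]; rfl
theorem rhoL_add (s : Sec I F L) (f g : SmoothFn I M) :
    C.rhoL s (f + g) = C.rhoL s f + C.rhoL s g := C.anchor.deriv_add _ _ _
theorem rhoL_mul (s : Sec I F L) (f g : SmoothFn I M) :
    C.rhoL s (f * g) = f * C.rhoL s g + g * C.rhoL s f := C.anchor.deriv_mul _ _ _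
theorem rhoL_neg (s : Sec I F L) (f : SmoothFn I M) : C.rhoL s (-f) = -C.rhoL s f :=
  C.deriv_neg _ _
theorem rhoL_const (s : Sec I F L) (c : ℝ) : C.rhoL s (algebraMap ℝ (SmoothFn I M) c) = 0 :=
  C.anchor.deriv_const _ _

theorem rhoDual_add_left (σ τ : Sec I (DualFiber F) (DualBundle L)) (f : SmoothFn I M) :
    C.rhoDual (σ + τ) f = C.rhoDual σ f + C.rhoDual τ f := by
  rw [rhoDual, inDual_add, C.anchor.deriv_add_left]; rfl
theorem rhoDual_smul_left (g : SmoothFn I M) (σ : Sec I (DualFiber F) (DualBundle L))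
    (f : SmoothFn I M) : C.rhoDual (g • σ) f = g * C.rhoDual σ f := by
  rw [rhoDual, inDual_smul, C.anchor.deriv_smul_left]; rfl
theorem rhoDual_add (σ : Sec I (DualFiber F) (DualBundle L)) (f g : SmoothFn I M) :
    C.rhoDual σ (f + g) = C.rhoDual σ f + C.rhoDual σ g := C.anchor.deriv_add _ _ _
theorem rhoDual_mul (σ : Sec I (DualFiber F) (DualBundle L)) (f g : SmoothFn I M) :
    C.rhoDual σ (f * g) = f * C.rhoDual σ g + g * C.rhoDual σ f := C.anchor.deriv_mul _ _ _
theorem rhoDual_neg (σ : Sec I (DualFiber F) (DualBundle L)) (f : SmoothFn I M) :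
    C.rhoDual σ (-f) = -C.rhoDual σ f := C.deriv_neg _ _

theorem phi_add (σ σ' τ υ : Sec I (DualFiber F) (DualBundle L)) :
    C.phi (σ + σ') τ υ = C.phi σ τ υ + C.phi σ' τ υ := by
  rw [phi, inDual_add, C.bracket_add_left, FiberMetric.pair_add_left, neg_add]; rfl

theorem phi_smul (f : SmoothFn I M) (σ τ υ : Sec I (DualFiber F) (DualBundle L)) :
    C.phi (f • σ) τ υ = f * C.phi σ τ υ := by
  rw [phi, inDual_smul, C.pair_bracket_smul_left, pair_inDual, pair_inDual, phi]
  ring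

theorem phi_swap (σ τ υ : Sec I (DualFiber F) (DualBundle L)) :
    C.phi τ σ υ = -C.phi σ τ υ := by
  have h := C.bracket_swap (inDual τ) (inDual σ) (inDual υ)
  rw [pair_inDual, C.deriv_zero] at h
  rw [phi, phi]
  linear_combination -h

theorem phi_swap' (σ τ υ : Sec I (DualFiber F) (DualBundle L)) :
    C.phi σ υ τ = -C.phi σ τ υ := by
  have h := C.metric_compat (inDual σ) (inDual τ) (inDual υ)
  rw [pair_inDual, C.deriv_zero, naturalPairing.pair_comm (inDual τ)] at h
  rw [phi, phi]
  linear_combination h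

end Components

end CourantAlgebroid

section Operators

variable [FiniteDimensional ℝ EM] [T2Space M] [IsManifold I ∞ M]
  [FiniteDimensional ℝ F] [ContMDiffVectorBundle ∞ F L I]

theorem smoothFn_two_torsion (r : SmoothFn I M) (h : r = -r) : r = 0 := by
  ext x
  have h1 : r x = -r x := congrArg (fun f : SmoothFn I M => f x) h
  change r x = 0
  linarith

theorem ap_ext {σ τ : Sec I (DualFiber F) (DualBundle L)}
    (h : ∀ s : Sec I F L, ap σ s = ap τ s) : σ = τ := by
  ext x v
  have h2 := congrArg (fun f : SmoothFn I M => f x) (h (extendSec x v))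
  have h3 : σ x ((extendSec x v : Sec I F L) x) = τ x ((extendSec x v : Sec I F L) x) := h2
  rwa [extendSec_apply] at h3

section Two
variable (α : Form I F L 2)

theorem ev_two_add (a a' b : Sec I F L) : α.ev ![a + a', b] = α.ev ![a, b] + α.ev ![a', b] :=
  (alt2_props α.toAlt).1 a a' b
theorem ev_two_smul (r : SmoothFn I M) (a b : Sec I F L) :
    α.ev ![r • a, b] = r * α.ev ![a, b] :=
  (alt2_props α.toAlt).2.1 r a b
theorem ev_two_swap (a b : Sec I F L) : α.ev ![b, a] = -α.ev ![a, b] :=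
  (alt2_props α.toAlt).2.2 a b
theorem ev_two_neg (a b : Sec I F L) : α.ev ![-a, b] = -α.ev ![a, b] := by
  have := ev_two_smul α (-1) a b
  simpa using this
theorem ev_two_add_right (a b b' : Sec I F L) :
    α.ev ![a, b + b'] = α.ev ![a, b] + α.ev ![a, b'] := by
  rw [ev_two_swap, ev_two_add, ev_two_swap α a b, ev_two_swap α a b']; ring
theorem ev_two_smul_right (r : SmoothFn I M) (a b : Sec I F L) :
    α.ev ![a, r • b] = r * α.ev ![a, b] := by
  rw [ev_two_swap, ev_two_smul, ev_two_swap α a b]; ring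

theorem flat_add_right (a b : Sec I F L) : flat α (a + b) = flat α a + flat α b :=
  ap_ext fun s => by simp only [ap_add_left, ap_flat, ev_two_add]
theorem flat_smul_right (r : SmoothFn I M) (a : Sec I F L) : flat α (r • a) = r • flat α a :=
  ap_ext fun s => by simp only [ap_smul_left, ap_flat, ev_two_smul]

end Two

section Three
variable (η : Form I F L 3)

theorem ev_three_add (a a' b c : Sec I F L) :
    η.ev ![a + a', b, c] = η.ev ![a, b, c] + η.ev ![a', b, c] :=
  (alt3_props η.toAlt).1 a a' b c
theorem ev_three_smul (r : SmoothFn I M) (a b c : Sec I F L) :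
    η.ev ![r • a, b, c] = r * η.ev ![a, b, c] :=
  (alt3_props η.toAlt).2.1 r a b c
theorem ev_three_swap (a b c : Sec I F L) : η.ev ![b, a, c] = -η.ev ![a, b, c] :=
  (alt3_props η.toAlt).2.2.1 a b c
theorem ev_three_swap' (a b c : Sec I F L) : η.ev ![a, c, b] = -η.ev ![a, b, c] :=
  (alt3_props η.toAlt).2.2.2 a b c
theorem ev_three_neg (a b c : Sec I F L) : η.ev ![-a, b, c] = -η.ev ![a, b, c] := by
  have := ev_three_smul η (-1) a b c
  simpa using this
theorem ev_three_add_mid (a b b' c : Sec I F L) :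
    η.ev ![a, b + b', c] = η.ev ![a, b, c] + η.ev ![a, b', c] := by
  rw [ev_three_swap, ev_three_add, ev_three_swap η a b, ev_three_swap η a b']; ring
theorem ev_three_smul_mid (r : SmoothFn I M) (a b c : Sec I F L) :
    η.ev ![a, r • b, c] = r * η.ev ![a, b, c] := by
  rw [ev_three_swap, ev_three_smul, ev_three_swap η a b]; ring
theorem ev_three_add_right (a b c c' : Sec I F L) :
    η.ev ![a, b, c + c'] = η.ev ![a, b, c] + η.ev ![a, b, c'] := by
  rw [ev_three_swap', ev_three_add_mid, ev_three_swap' η a b c, ev_three_swap' η a b c']; ring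
theorem ev_three_smul_right (r : SmoothFn I M) (a b c : Sec I F L) :
    η.ev ![a, b, r • c] = r * η.ev ![a, b, c] := by
  rw [ev_three_swap', ev_three_smul_mid, ev_three_swap' η a b c]; ring

end Three

theorem ev_form_add {k : ℕ} (α β : Form I F L k) (s : Fin k → Sec I F L) :
    (α + β).ev s = α.ev s + β.ev s := rfl
theorem ev_form_smul {k : ℕ} (r : ℝ) (α : Form I F L k) (s : Fin k → Sec I F L) :
    (r • α).ev s = algebraMap ℝ (SmoothFn I M) r * α.ev s := rfl

namespace CourantAlgebroid

variable (C : CourantAlgebroid (naturalPairing (I := I) (F := F) (L := L)))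

/-- The value `(d_L α)(a, b, c)` of the Lie algebroid differential of a two-form `α`. -/
def dTwoFun (α : Form I F L 2) (a b c : Sec I F L) : SmoothFn I M :=
  C.rhoL a (α.ev ![b, c]) - C.rhoL b (α.ev ![a, c]) + C.rhoL c (α.ev ![a, b])
    - α.ev ![C.brL a b, c] + α.ev ![C.brL a c, b] - α.ev ![C.brL b c, a]

/-- The Lie algebroid differential `d_L : Γ(Λ² L*) → Γ(Λ³ L*)`. -/
def dTwoForm (α : Form I F L 2) : Form I F L 3 :=
  Form.ofAlt <| mkAlt3 (C.dTwoFun α) smoothFn_two_torsion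
    (fun a a' b c => by
      simp only [dTwoFun, ev_two_add, ev_two_add_right, C.rhoL_add_left, C.rhoL_add,
        C.brL_add_left]
      ring)
    (fun r a b c => by
      simp only [dTwoFun, ev_two_add, ev_two_smul, ev_two_smul_right, C.rhoL_smul_left,
        C.rhoL_mul, C.brL_smul_left]
      rw [ev_two_swap α b a]
      ring)
    (fun a b c => by
      simp only [dTwoFun]
      rw [C.brL_skew a b, ev_two_neg, ev_two_swap α a b, C.rhoL_neg]
      ring)
    (fun a b c => by
      simp only [dTwoFun]
      rw [C.brL_skew b c, ev_two_neg, ev_two_swap α b c, C.rhoL_neg]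
      ring)

theorem ev_dTwoForm (α : Form I F L 2) (s : Fin 3 → Sec I F L) :
    (C.dTwoForm α).ev s = C.dTwoFun α (s 0) (s 1) (s 2) := Form.ev_ofAlt _ _

theorem dTwoFun_add (α β : Form I F L 2) (a b c : Sec I F L) :
    C.dTwoFun (α + β) a b c = C.dTwoFun α a b c + C.dTwoFun β a b c := by
  simp only [dTwoFun, ev_form_add, C.rhoL_add]
  ring

theorem dTwoFun_smul (r : ℝ) (α : Form I F L 2) (a b c : Sec I F L) :
    C.dTwoFun (r • α) a b c = algebraMap ℝ (SmoothFn I M) r * C.dTwoFun α a b c := by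
  simp only [dTwoFun, ev_form_smul, C.rhoL_mul, C.rhoL_const]
  ring

/-- The Lie algebroid differential `d_L` as a linear map. -/
def dTwo : Form I F L 2 →ₗ[ℝ] Form I F L 3 where
  toFun := C.dTwoForm
  map_add' α β := Form.ext_ev fun s =>
    (C.ev_dTwoForm (α + β) s).trans <| (C.dTwoFun_add α β (s 0) (s 1) (s 2)).trans <|
      congrArg₂ (· + ·) (C.ev_dTwoForm α s).symm (C.ev_dTwoForm β s).symm
  map_smul' r α := Form.ext_ev fun s =>
    (C.ev_dTwoForm (r • α) s).trans <| (C.dTwoFun_smul r α (s 0) (s 1) (s 2)).trans <|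
      congrArg (_ * ·) (C.ev_dTwoForm α s).symm

theorem ev_dTwo (α : Form I F L 2) (a b c : Sec I F L) :
    (C.dTwo α).ev ![a, b, c] = C.dTwoFun α a b c := Form.ev_ofAlt _ _

/-- The value `(d_L η)(a, b, c, d)` of the Lie algebroid differential of a three-form `η`. -/
def dThreeFun (η : Form I F L 3) (a b c d : Sec I F L) : SmoothFn I M :=
  C.rhoL a (η.ev ![b, c, d]) - C.rhoL b (η.ev ![a, c, d])
    + C.rhoL c (η.ev ![a, b, d]) - C.rhoL d (η.ev ![a, b, c])
    - η.ev ![C.brL a b, c, d] + η.ev ![C.brL a c, b, d] - η.ev ![C.brL a d, b, c]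
    - η.ev ![C.brL b c, a, d] + η.ev ![C.brL b d, a, c] - η.ev ![C.brL c d, a, b]

/-- The Lie algebroid differential `d_L : Γ(Λ³ L*) → Γ(Λ⁴ L*)`. -/
def dThreeForm (η : Form I F L 3) : Form I F L 4 :=
  Form.ofAlt <| mkAlt4 (C.dThreeFun η) smoothFn_two_torsion
    (fun a a' b c d => by
      simp only [dThreeFun, ev_three_add, ev_three_add_mid, C.rhoL_add_left, C.rhoL_add,
        C.brL_add_left]
      ring)
    (fun r a b c d => by
      simp only [dThreeFun, ev_three_add, ev_three_smul, ev_three_smul_mid, C.rhoL_smul_left,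
        C.rhoL_mul, C.brL_smul_left]
      ring)
    (fun a b c d => by
      simp only [dThreeFun]
      rw [C.brL_skew a b, ev_three_neg, ev_three_swap η a b d, ev_three_swap η a b c, C.rhoL_neg,
        C.rhoL_neg, ev_three_swap' η (C.brL c d) a b]
      ring)
    (fun a b c d => by
      simp only [dThreeFun]
      rw [C.brL_skew b c, ev_three_neg, ev_three_swap η b c d, ev_three_swap' η a b c, C.rhoL_neg,
        C.rhoL_neg, ev_three_swap' η (C.brL a d) b c]
      ring)
    (fun a b c d => by
      simp only [dThreeFun]
      rw [C.brL_skew c d, ev_three_neg, ev_three_swap' η b c d, ev_three_swap' η a c d,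
        C.rhoL_neg, C.rhoL_neg, ev_three_swap' η (C.brL a b) c d]
      ring)

theorem ev_dThreeForm (η : Form I F L 3) (s : Fin 4 → Sec I F L) :
    (C.dThreeForm η).ev s = C.dThreeFun η (s 0) (s 1) (s 2) (s 3) := Form.ev_ofAlt _ _

theorem dThreeFun_add (α β : Form I F L 3) (a b c d : Sec I F L) :
    C.dThreeFun (α + β) a b c d = C.dThreeFun α a b c d + C.dThreeFun β a b c d := by
  simp only [dThreeFun, ev_form_add, C.rhoL_add]
  ring

theorem dThreeFun_smul (r : ℝ) (α : Form I F L 3) (a b c d : Sec I F L) :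
    C.dThreeFun (r • α) a b c d = algebraMap ℝ (SmoothFn I M) r * C.dThreeFun α a b c d := by
  simp only [dThreeFun, ev_form_smul, C.rhoL_mul, C.rhoL_const]
  ring

/-- The Lie algebroid differential `d_L` as a linear map. -/
def dThree : Form I F L 3 →ₗ[ℝ] Form I F L 4 where
  toFun := C.dThreeForm
  map_add' α β := Form.ext_ev fun s =>
    (C.ev_dThreeForm (α + β) s).trans <| (C.dThreeFun_add α β (s 0) (s 1) (s 2) (s 3)).trans <|
      congrArg₂ (· + ·) (C.ev_dThreeForm α s).symm (C.ev_dThreeForm β s).symm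
  map_smul' r α := Form.ext_ev fun s =>
    (C.ev_dThreeForm (r • α) s).trans <| (C.dThreeFun_smul r α (s 0) (s 1) (s 2) (s 3)).trans <|
      congrArg (_ * ·) (C.ev_dThreeForm α s).symm

theorem ev_dThree (η : Form I F L 3) (a b c d : Sec I F L) :
    (C.dThree η).ev ![a, b, c, d] = C.dThreeFun η a b c d := Form.ev_ofAlt _ _

/-- The part of the Schouten bracket of `P` and `Q` that is summed over the cyclic permutations
of `(a, b, c)`. -/
def schoutenAux (P Q : Form I F L 2) (a b c : Sec I F L) : SmoothFn I M :=
  ap (C.brDual (flat P a) (flat Q b)) c + ap (C.brDual (flat Q a) (flat P b)) c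
    - C.rhoDual (flat P a) (Q.ev ![b, c]) - C.rhoDual (flat Q a) (P.ev ![b, c])

/-- The Schouten-Nijenhuis bracket `[P, Q]_γ ∈ Γ(Λ³ L*)` of `P, Q ∈ Γ(Λ² L*)`, built from the
bracket and the anchor of `L*`; see `schouten_wedge` for its values on decomposable elements. -/
def schouten (P Q : Form I F L 2) : Form I F L 3 :=
  Form.ofAlt <| mkAlt3
    (fun a b c => C.schoutenAux P Q a b c + C.schoutenAux P Q b c a + C.schoutenAux P Q c a b)
    smoothFn_two_torsion
    (fun a a' b c => by
      simp only [schoutenAux, ev_two_add, ev_two_add_right, flat_add_right, C.rhoDual_add_left,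
        C.rhoDual_add, C.brDual_add_left, C.brDual_add_right, ap_add_left, ap_add_right]
      ring)
    (fun r a b c => by
      simp only [schoutenAux, ev_two_smul, ev_two_smul_right, flat_smul_right, C.rhoDual_smul_left,
        C.rhoDual_mul, C.brDual_smul_left, C.brDual_smul_right, ap_add_left, ap_smul_left,
        ap_smul_right, ap_flat]
      rw [ev_two_swap P a c, ev_two_swap Q a c]
      ring)
    (fun a b c => by
      simp only [schoutenAux]
      rw [C.brDual_skew (flat P a) (flat Q b), C.brDual_skew (flat Q a) (flat P b),
        C.brDual_skew (flat P a) (flat Q c), C.brDual_skew (flat Q a) (flat P c),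
        C.brDual_skew (flat P b) (flat Q c), C.brDual_skew (flat Q b) (flat P c),
        ev_two_swap P a b, ev_two_swap Q a b, ev_two_swap P b c, ev_two_swap Q b c,
        ev_two_swap P c a, ev_two_swap Q c a]
      simp only [C.rhoDual_neg, ap_neg_left]
      ring)
    (fun a b c => by
      simp only [schoutenAux]
      rw [C.brDual_skew (flat P a) (flat Q b), C.brDual_skew (flat Q a) (flat P b),
        C.brDual_skew (flat P a) (flat Q c), C.brDual_skew (flat Q a) (flat P c),
        C.brDual_skew (flat P b) (flat Q c), C.brDual_skew (flat Q b) (flat P c),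
        ev_two_swap P a b, ev_two_swap Q a b, ev_two_swap P b c, ev_two_swap Q b c,
        ev_two_swap P c a, ev_two_swap Q c a]
      simp only [C.rhoDual_neg, ap_neg_left]
      ring)

theorem ev_schouten (P Q : Form I F L 2) (a b c : Sec I F L) :
    (C.schouten P Q).ev ![a, b, c] =
      C.schoutenAux P Q a b c + C.schoutenAux P Q b c a + C.schoutenAux P Q c a b :=
  Form.ev_ofAlt _ _

/-- The trilinear bracket `[η₁, η₂, η₃]_φ ∈ Γ(Λ³ L*)` of two-forms, the symmetric polarization of
`[η, η, η]_φ(a, b, c) = -6 φ(η(a), η(b), η(c))`. -/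
def tripleBracket (η₁ η₂ η₃ : Form I F L 2) : Form I F L 3 :=
  Form.ofAlt <| mkAlt3
    (fun a b c => -(
      C.phi (flat η₁ a) (flat η₂ b) (flat η₃ c) + C.phi (flat η₂ a) (flat η₃ b) (flat η₁ c) +
      C.phi (flat η₃ a) (flat η₁ b) (flat η₂ c) + C.phi (flat η₂ a) (flat η₁ b) (flat η₃ c) +
      C.phi (flat η₁ a) (flat η₃ b) (flat η₂ c) + C.phi (flat η₃ a) (flat η₂ b) (flat η₁ c)))
    smoothFn_two_torsion
    (fun a a' b c => by
      simp only [flat_add_right, C.phi_add]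
      ring)
    (fun r a b c => by
      simp only [flat_smul_right, C.phi_smul]
      ring)
    (fun a b c => by
      rw [C.phi_swap (flat η₁ a), C.phi_swap (flat η₁ a), C.phi_swap (flat η₂ a),
        C.phi_swap (flat η₂ a), C.phi_swap (flat η₃ a), C.phi_swap (flat η₃ a)]
      ring)
    (fun a b c => by
      rw [C.phi_swap' _ (flat η₁ b), C.phi_swap' _ (flat η₁ b), C.phi_swap' _ (flat η₂ b),
        C.phi_swap' _ (flat η₂ b), C.phi_swap' _ (flat η₃ b), C.phi_swap' _ (flat η₃ b)]
      ring)

theorem ev_tripleBracket (η₁ η₂ η₃ : Form I F L 2) (a b c : Sec I F L) :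
    (C.tripleBracket η₁ η₂ η₃).ev ![a, b, c] = -(
      C.phi (flat η₁ a) (flat η₂ b) (flat η₃ c) + C.phi (flat η₂ a) (flat η₃ b) (flat η₁ c) +
      C.phi (flat η₃ a) (flat η₁ b) (flat η₂ c) + C.phi (flat η₂ a) (flat η₁ b) (flat η₃ c) +
      C.phi (flat η₁ a) (flat η₃ b) (flat η₂ c) + C.phi (flat η₃ a) (flat η₂ b) (flat η₁ c)) :=
  Form.ev_ofAlt _ _

/-- The value of `σ ∧ τ ∧ υ` on `(a, b, c)`. -/
def wedge₃ (σ τ υ : Sec I (DualFiber F) (DualBundle L)) (a b c : Sec I F L) : SmoothFn I M :=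
  ap σ a * (ap τ b * ap υ c - ap τ c * ap υ b) - ap σ b * (ap τ a * ap υ c - ap τ c * ap υ a) +
    ap σ c * (ap τ a * ap υ b - ap τ b * ap υ a)

/-- If `P = σ₁ ∧ σ₂` and `Q = τ₁ ∧ τ₂`, then `[P, Q]_γ = ∑ i j, (-1)^(i+j) [σᵢ, τⱼ] ∧ σ̂ᵢ ∧ τ̂ⱼ`, where
`σ̂ᵢ`, `τ̂ⱼ` are the other factors. -/
theorem schouten_wedge (σ₁ σ₂ τ₁ τ₂ : Sec I (DualFiber F) (DualBundle L)) (P Q : Form I F L 2)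
    (hP : ∀ a b, P.ev ![a, b] = ap σ₁ a * ap σ₂ b - ap σ₂ a * ap σ₁ b)
    (hQ : ∀ a b, Q.ev ![a, b] = ap τ₁ a * ap τ₂ b - ap τ₂ a * ap τ₁ b) (a b c : Sec I F L) :
    (C.schouten P Q).ev ![a, b, c] =
      wedge₃ (C.brDual σ₁ τ₁) σ₂ τ₂ a b c - wedge₃ (C.brDual σ₁ τ₂) σ₂ τ₁ a b c
      - wedge₃ (C.brDual σ₂ τ₁) σ₁ τ₂ a b c + wedge₃ (C.brDual σ₂ τ₂) σ₁ τ₁ a b c := by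
  have hp (s : Sec I F L) : flat P s = ap σ₁ s • σ₂ + (-ap σ₂ s) • σ₁ := ap_ext fun t => by
    rw [ap_flat, hP, ap_add_left, ap_smul_left, ap_smul_left]; ring
  have hq (s : Sec I F L) : flat Q s = ap τ₁ s • τ₂ + (-ap τ₂ s) • τ₁ := ap_ext fun t => by
    rw [ap_flat, hQ, ap_add_left, ap_smul_left, ap_smul_left]; ring
  rw [ev_schouten]
  have hsub (σ : Sec I (DualFiber F) (DualBundle L)) (f g : SmoothFn I M) :
      C.rhoDual σ (f - g) = C.rhoDual σ f - C.rhoDual σ g := by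
    rw [sub_eq_add_neg, C.rhoDual_add, C.rhoDual_neg]; ring
  simp only [schoutenAux, hP, hQ, hp, hq, wedge₃, C.brDual_add_left,
    C.brDual_add_right, C.brDual_smul_left, C.brDual_smul_right, ap_add_left, ap_smul_left,
    C.rhoDual_add_left, C.rhoDual_smul_left, hsub, C.rhoDual_mul, C.rhoDual_neg]
  rw [C.brDual_skew σ₁ τ₁, C.brDual_skew σ₁ τ₂, C.brDual_skew σ₂ τ₁, C.brDual_skew σ₂ τ₂]
  simp only [ap_neg_left]
  ring

end CourantAlgebroid

end Operators

section Formal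

variable [FiniteDimensional ℝ EM] [T2Space M] [IsManifold I ∞ M]
  [FiniteDimensional ℝ F] [ContMDiffVectorBundle ∞ F L I]

namespace CourantAlgebroid

variable (C : CourantAlgebroid (naturalPairing (I := I) (F := F) (L := L)))

/-- The third Lie algebroid cohomology of `L`: the closed three-forms modulo the exact ones. -/
abbrev H3 : Type _ :=
  LinearMap.ker C.dThree ⧸ (LinearMap.range C.dTwo).submoduleOf (LinearMap.ker C.dThree)

/-- The cohomology class of a closed three-form. -/
def cohomologyClass : LinearMap.ker C.dThree →ₗ[ℝ] C.H3 :=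
  ((LinearMap.range C.dTwo).submoduleOf (LinearMap.ker C.dThree)).mkQ

/-- The coefficient of `t ^ n` in `d_L w + ½ [w, w]_γ + ⅙ [w, w, w]_φ`, for the formal power series
`w = ∑ r, t ^ r w_r`. -/
def mcCoeff (w : ℕ → Form I F L 2) (n : ℕ) : Form I F L 3 :=
  C.dTwo (w n) +
    (1 / 2 : ℝ) • ∑ p ∈ Finset.HasAntidiagonal.antidiagonal n, C.schouten (w p.1) (w p.2) +
    (1 / 6 : ℝ) • ∑ p ∈ Finset.HasAntidiagonal.antidiagonal n,
      ∑ q ∈ Finset.HasAntidiagonal.antidiagonal p.2, C.tripleBracket (w p.1) (w q.1) (w q.2)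

/-- `w = t w₁ + ⋯ + t ^ N w_N` is a formal deformation of `L` of order `N`: it satisfies
`d_L w + ½ [w, w]_γ + ⅙ [w, w, w]_φ = 0` up to order `N`. -/
structure IsFormalDeformation (N : ℕ) (w : ℕ → Form I F L 2) : Prop where
  zero : w 0 = 0
  eq_zero_of_lt : ∀ r, N < r → w r = 0
  equation : ∀ n ≤ N, C.mcCoeff w n = 0

/-- `w = t w₁ + ⋯ + t ^ N w_N` extends to a formal deformation of order `N + 1`, by some
coefficient `w_{N+1}`. -/
def Extends (N : ℕ) (w : ℕ → Form I F L 2) : Prop :=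
  ∃ w' : ℕ → Form I F L 2, C.IsFormalDeformation (N + 1) w' ∧ ∀ r ≤ N, w' r = w r

/-- The remainder `R_{N+1} = -½ ∑_{i=1}^N [w_i, w_{N+1-i}]_γ - ⅙ ∑_{i+j+k=N+1} [w_i, w_j, w_k]_φ`,
where `i, j, k ≥ 1` in the second sum. -/
def remainder (N : ℕ) (w : ℕ → Form I F L 2) : Form I F L 3 :=
  -((1 / 2 : ℝ) • ∑ i ∈ Finset.Icc 1 N, C.schouten (w i) (w (N + 1 - i))) -
    (1 / 6 : ℝ) • ∑ p ∈ (Finset.Icc 1 N ×ˢ Finset.Icc 1 N ×ˢ Finset.Icc 1 N).filter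
      (fun p => p.1 + p.2.1 + p.2.2 = N + 1), C.tripleBracket (w p.1) (w p.2.1) (w p.2.2)

end CourantAlgebroid

end Formal

end Double

end DiracDeformation

end

/-! The graph of a two-form `α` consists of the sections `a + α(a)`, and it is isotropic because `α`
is skew. Its failure to be closed under the Courant bracket is the three-form `⟨[a + α(a), b +
α(b)], c + α(c)⟩`. Expanding this by the number of entries from `L*` gives zero, `d_L α`, half the
Schouten bracket and a sixth of the triple bracket, so the three-form is the Maurer-Cartan
expression `MC(α)` (`ev_maurerCartan`). The Dirac property of `L` is what removes the term without
entries from `L*`.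

All compatibilities between `d_L`, the Schouten bracket and `φ` are contained in one identity. The
Jacobi identity of the Courant algebroid, paired with a fourth section (`pair_jacobi`) and taken on
four graph sections, becomes a Bianchi identity (`graphDeriv_maurerCartan`): `MC(α)` is annihilated
by the operator `graphDeriv α`, given by the Cartan formula for a differential with anchor `ρ(a +
α(a))` and bracket `pr_L [a + α(a), b + α(b)]`. For `α = 0` this operator is `d_L`.

Now let `α_t = t w₁ + ⋯ + t ^ N w_N` be a deformation of order `N`. Then `MC(α_t) = t ^ (N + 1)
η_t`, with `η_t` polynomial in `t` and `η_0` the coefficient of `t ^ (N + 1)`. For `t ≠ 0` the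
Bianchi identity can be divided by `t ^ (N + 1)`, so `graphDeriv α_t η_t = 0`. The left side,
evaluated at a point, is a polynomial in `t`, so it also vanishes at `t = 0`, which says `d_L η_0 =
0` (`dThree_mcCoeff`).

Since the constant term of a deformation vanishes, a new coefficient `w_{N+1}` enters the
coefficient of `t ^ (N + 1)` only through `d_L w_{N+1}`; that coefficient equals `d_L w_{N+1} -
R_{N+1}` (`mcCoeff_succ`). With `w_{N+1} = 0` this gives closedness of the remainder, and with a
free `w_{N+1}` it gives the criterion for extension. -/

noncomputable section

namespace DiracDeformation

/-! ### Curves in a vector space that are polynomial in `t` -/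

section PolynomialCurves

variable {U V W : Type*} [AddCommGroup U] [Module ℝ U] [AddCommGroup V] [Module ℝ V]
  [AddCommGroup W] [Module ℝ W]

variable (V) in
/-- The curves in a real vector space that are polynomial in the parameter. -/
def polyCurve : Submodule ℝ (ℝ → V) :=
  Submodule.span ℝ {g | ∃ (n : ℕ) (v : V), g = fun t => t ^ n • v}

theorem polyCurve_monomial (n : ℕ) (v : V) : (fun t : ℝ => t ^ n • v) ∈ polyCurve V :=
  Submodule.subset_span ⟨n, v, rfl⟩

theorem polyCurve_const (v : V) : (fun _ : ℝ => v) ∈ polyCurve V := by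
  simpa using polyCurve_monomial 0 v

theorem polyCurve_sum {ι : Type*} (s : Finset ι) (n : ι → ℕ) (v : ι → V) :
    (fun t : ℝ => ∑ i ∈ s, t ^ n i • v i) ∈ polyCurve V := by
  have := (polyCurve V).sum_mem (t := s) fun i _ => polyCurve_monomial (n i) (v i)
  convert this using 1
  ext t
  simp

theorem polyCurve_map (l : U →ₗ[ℝ] V) {g : ℝ → U} (hg : g ∈ polyCurve U) :
    (fun t => l (g t)) ∈ polyCurve V := by
  induction hg using Submodule.span_induction with
  | mem g hg =>
    obtain ⟨n, v, rfl⟩ := hg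
    simpa using polyCurve_monomial n (l v)
  | zero => simpa only [Pi.zero_apply, map_zero] using! (polyCurve V).zero_mem
  | add g g' _ _ hg hg' => simpa using! (polyCurve V).add_mem hg hg'
  | smul r g _ hg => simpa using! (polyCurve V).smul_mem r hg

/-- Both arguments reduce to monomials, whose exponents add. Together with `polyCurve_map` this
makes any expression built from real multilinear operations polynomial in `t`, without computing its
coefficients. -/
theorem polyCurve_map₂ (B : U →ₗ[ℝ] V →ₗ[ℝ] W) {g : ℝ → U} {k : ℝ → V}
    (hg : g ∈ polyCurve U) (hk : k ∈ polyCurve V) : (fun t => B (g t) (k t)) ∈ polyCurve W := by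
  induction hg using Submodule.span_induction with
  | mem g hg =>
    obtain ⟨n, u, rfl⟩ := hg
    induction hk using Submodule.span_induction with
    | mem k hk =>
      obtain ⟨m, v, rfl⟩ := hk
      simpa [smul_smul, ← pow_add] using polyCurve_monomial (m + n) (B u v)
    | zero => simpa only [Pi.zero_apply, map_zero] using! (polyCurve W).zero_mem
    | add k k' _ _ hk hk' => simpa using! (polyCurve W).add_mem hk hk'
    | smul r k _ hk =>
      have := (polyCurve W).smul_mem r hk
      convert this using 1
      ext t
      simp [smul_comm r]
  | zero =>
    simpa only [Pi.zero_apply, map_zero, LinearMap.zero_apply] using! (polyCurve W).zero_mem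
  | add g g' _ _ hg hg' => simpa using! (polyCurve W).add_mem hg hg'
  | smul r g _ hg => simpa using! (polyCurve W).smul_mem r hg

theorem polyCurve_add {g k : ℝ → V} (hg : g ∈ polyCurve V) (hk : k ∈ polyCurve V) :
    (fun t => g t + k t) ∈ polyCurve V :=
  (polyCurve V).add_mem hg hk

theorem polyCurve_sub {g k : ℝ → V} (hg : g ∈ polyCurve V) (hk : k ∈ polyCurve V) :
    (fun t => g t - k t) ∈ polyCurve V :=
  (polyCurve V).sub_mem hg hk

theorem continuous_of_mem_polyCurve {g : ℝ → ℝ} (hg : g ∈ polyCurve ℝ) : Continuous g := by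
  induction hg using Submodule.span_induction with
  | mem g hg =>
    obtain ⟨n, v, rfl⟩ := hg
    fun_prop
  | zero => exact continuous_zero
  | add g g' _ _ hg hg' => exact hg.add hg'
  | smul r g _ hg => exact hg.const_smul r

/-- The punctured line is dense and polynomials are continuous. This recovers the value at `t = 0`
of an identity obtained after dividing by a power of `t`. -/
theorem polyCurve_apply_zero {g : ℝ → ℝ} (hg : g ∈ polyCurve ℝ) (h : ∀ t, t ≠ 0 → g t = 0) :
    g 0 = 0 := by
  have h1 : Set.EqOn g 0 {0}ᶜ := fun t ht => h t ht
  exact congrFun ((continuous_of_mem_polyCurve hg).ext_on (dense_compl_singleton 0)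
    continuous_zero h1) 0

/-! ### Multilinear maps on polynomials, sorted by powers of `t` -/

/-- Pairs are grouped by `i + j`; a pair on an antidiagonal but outside the rectangle contributes
zero by `h1` or `h2`. The bound `m` may be larger than necessary, so that terms of different degree
can be written over one common range. -/
theorem sum_range_sum_range_eq_antidiagonal {K K' m : ℕ} (hm : K + K' ≤ m) (f : ℕ → ℕ → V)
    (h1 : ∀ i j, K ≤ i → f i j = 0) (h2 : ∀ i j, K' ≤ j → f i j = 0) :
    ∑ i ∈ Finset.range K, ∑ j ∈ Finset.range K', f i j =
      ∑ n ∈ Finset.range m, ∑ p ∈ Finset.HasAntidiagonal.antidiagonal n, f p.1 p.2 := by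
  rw [← Finset.sum_product', ← Finset.sum_fiberwise_of_maps_to (t := Finset.range m)
    (g := fun p : ℕ × ℕ => p.1 + p.2)
    (fun p hp => by simp only [Finset.mem_product, Finset.mem_range] at hp ⊢; omega)]
  refine Finset.sum_congr rfl fun n _ => Finset.sum_subset (fun p hp => ?_) fun p hp hp' => ?_
  · simpa using (Finset.mem_filter.1 hp).2
  · simp only [Finset.mem_filter, Finset.mem_product, Finset.mem_range,
      Finset.HasAntidiagonal.mem_antidiagonal] at hp hp'
    by_cases h : K ≤ p.1
    · exact h1 _ _ h
    · exact h2 _ _ (by omega)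

theorem map_sum_pow_smul (l : U →ₗ[ℝ] W) {u : ℕ → U} {K m : ℕ} (hm : K ≤ m)
    (hu : ∀ i, K ≤ i → u i = 0) (t : ℝ) :
    l (∑ i ∈ Finset.range K, t ^ i • u i) = ∑ n ∈ Finset.range m, t ^ n • l (u n) := by
  simp only [map_sum, map_smul]
  refine Finset.sum_subset (Finset.range_mono hm) fun n _ hn => ?_
  rw [hu n (by simpa using hn), map_zero, smul_zero]

theorem map₂_sum_pow_smul (B : U →ₗ[ℝ] V →ₗ[ℝ] W) {u : ℕ → U} {v : ℕ → V} {K K' m : ℕ}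
    (hm : K + K' ≤ m) (hu : ∀ i, K ≤ i → u i = 0) (hv : ∀ j, K' ≤ j → v j = 0) (t : ℝ) :
    B (∑ i ∈ Finset.range K, t ^ i • u i) (∑ j ∈ Finset.range K', t ^ j • v j) =
      ∑ n ∈ Finset.range m, t ^ n •
        ∑ p ∈ Finset.HasAntidiagonal.antidiagonal n, B (u p.1) (v p.2) := by
  have h : B (∑ i ∈ Finset.range K, t ^ i • u i) (∑ j ∈ Finset.range K', t ^ j • v j) =
      ∑ i ∈ Finset.range K, ∑ j ∈ Finset.range K', t ^ (i + j) • B (u i) (v j) := by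
    simp only [map_sum, LinearMap.sum_apply, map_smul, LinearMap.smul_apply, Finset.smul_sum,
      smul_smul, ← pow_add]
    rw [Finset.sum_comm]
    simp only [add_comm]
  rw [h, sum_range_sum_range_eq_antidiagonal hm (fun i j => t ^ (i + j) • B (u i) (v j))
    (fun i j hi => by simp [hu i hi]) fun i j hj => by simp [hv j hj]]
  refine Finset.sum_congr rfl fun n _ => ?_
  rw [Finset.smul_sum]
  refine Finset.sum_congr rfl fun p hp => ?_
  rw [Finset.HasAntidiagonal.mem_antidiagonal.1 hp]

/-- Two Cauchy products: one for the bilinear map `T (u i)`, of length `2 * K`, and one for the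
outer index. This produces the nested antidiagonals of `mcCoeff`. -/
theorem map₃_sum_pow_smul (T : U →ₗ[ℝ] U →ₗ[ℝ] U →ₗ[ℝ] W) {u : ℕ → U} {K : ℕ}
    (hu : ∀ i, K ≤ i → u i = 0) (t : ℝ) :
    T (∑ i ∈ Finset.range K, t ^ i • u i) (∑ i ∈ Finset.range K, t ^ i • u i)
        (∑ i ∈ Finset.range K, t ^ i • u i) =
      ∑ n ∈ Finset.range (3 * K), t ^ n • ∑ p ∈ Finset.HasAntidiagonal.antidiagonal n,
        ∑ q ∈ Finset.HasAntidiagonal.antidiagonal p.2, T (u p.1) (u q.1) (u q.2) := by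
  let f (i n : ℕ) : W := ∑ q ∈ Finset.HasAntidiagonal.antidiagonal n, T (u i) (u q.1) (u q.2)
  -- If two indices add up to at least `2 * K`, one of them is at least `K`.
  have hf (i j : ℕ) (hj : 2 * K ≤ j) : f i j = 0 := Finset.sum_eq_zero fun q hq => by
    have := Finset.HasAntidiagonal.mem_antidiagonal.1 hq
    by_cases h1 : K ≤ q.1
    · simp [hu _ h1]
    · simp [hu q.2 (by omega)]
  have h : T (∑ i ∈ Finset.range K, t ^ i • u i) (∑ i ∈ Finset.range K, t ^ i • u i)
      (∑ i ∈ Finset.range K, t ^ i • u i) =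
      ∑ i ∈ Finset.range K, ∑ j ∈ Finset.range (2 * K), t ^ (i + j) • f i j := by
    rw [map_sum T, LinearMap.sum_apply, LinearMap.sum_apply]
    refine Finset.sum_congr rfl fun i _ => ?_
    rw [map_smul, LinearMap.smul_apply, LinearMap.smul_apply,
      map₂_sum_pow_smul (T (u i)) (m := 2 * K) (by omega) hu hu, Finset.smul_sum]
    simp only [smul_smul, ← pow_add, f]
  rw [h, sum_range_sum_range_eq_antidiagonal (m := 3 * K) (by omega)
    (fun i j => t ^ (i + j) • f i j) (fun i j hi => by simp [f, hu i hi])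
    fun i j hj => by rw [hf i j hj, smul_zero]]
  refine Finset.sum_congr rfl fun n _ => ?_
  rw [Finset.smul_sum]
  refine Finset.sum_congr rfl fun p hp => ?_
  rw [Finset.HasAntidiagonal.mem_antidiagonal.1 hp]

end PolynomialCurves

/-! ### Real bilinearity and the Jacobi identity of a Courant algebroid -/

section Courant

variable {EM : Type*} [NormedAddCommGroup EM] [NormedSpace ℝ EM] [FiniteDimensional ℝ EM]
  {HM : Type*} [TopologicalSpace HM] {I : ModelWithCorners ℝ EM HM}
  {M : Type*} [TopologicalSpace M] [ChartedSpace HM M] [T2Space M] [IsManifold I ∞ M]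
  {F : Type*} [NormedAddCommGroup F] [NormedSpace ℝ F] [FiniteDimensional ℝ F]
  {E : M → Type*} [TopologicalSpace (TotalSpace F E)]
  [∀ x, AddCommGroup (E x)] [∀ x, Module ℝ (E x)] [∀ x, TopologicalSpace (E x)]
  [FiberBundle F E] [VectorBundle ℝ F E] [ContMDiffVectorBundle ∞ F E I]

theorem algebraMap_smulSec (r : ℝ) (s : Sec I F E) :
    algebraMap ℝ (SmoothFn I M) r • s = r • s := rfl

/-- The derivative along the anchor as a real bilinear map. -/
def Anchor.derivₗ (r : Anchor I F E) : Sec I F E →ₗ[ℝ] SmoothFn I M →ₗ[ℝ] SmoothFn I M :=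
  LinearMap.mk₂ ℝ r.deriv r.deriv_add_left
    (fun c s f => by rw [← algebraMap_smulSec, r.deriv_smul_left, Algebra.smul_def])
    r.deriv_add
    (fun c s f => by
      rw [Algebra.smul_def, r.deriv_mul, r.deriv_const, Algebra.smul_def, mul_zero, add_zero])

namespace CourantAlgebroid

variable {h : FiberMetric I F E} (C : CourantAlgebroid h)

/-- The Courant bracket as a real bilinear map. -/
def bracketₗ : Sec I F E →ₗ[ℝ] Sec I F E →ₗ[ℝ] Sec I F E :=
  LinearMap.mk₂ ℝ C.bracket C.bracket_add_left
    -- The correction terms in the Leibniz rule for the first argument are derivatives of the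
    -- coefficient, here a constant.
    (fun c a b => h.pair_ext fun u => by
      rw [← algebraMap_smulSec, ← algebraMap_smulSec, C.pair_bracket_smul_left,
        C.anchor.deriv_const, C.anchor.deriv_const, h.pair_smul_left]
      ring)
    C.bracket_add_right
    (fun c a b => by
      rw [← algebraMap_smulSec, C.bracket_smul_right, C.anchor.deriv_const, zero_smul, add_zero,
        algebraMap_smulSec])

/-- The Jacobi identity of a Courant algebroid, paired with a fourth section. -/
theorem pair_jacobi (e₁ e₂ e₃ e₄ : Sec I F E) :
    C.anchor.deriv e₁ (h.pair (C.bracket e₂ e₃) e₄)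
      - C.anchor.deriv e₂ (h.pair (C.bracket e₁ e₃) e₄)
      + C.anchor.deriv e₃ (h.pair (C.bracket e₁ e₂) e₄)
      - C.anchor.deriv e₄ (h.pair (C.bracket e₁ e₂) e₃)
      - h.pair (C.bracket e₁ e₂) (C.bracket e₃ e₄)
      + h.pair (C.bracket e₁ e₃) (C.bracket e₂ e₄)
      - h.pair (C.bracket e₂ e₃) (C.bracket e₁ e₄) = 0 := by
  have h1 := congrArg (h.pair · e₄) (C.jacobi e₁ e₂ e₃)
  simp only [h.pair_add_left] at h1
  have h2 := C.metric_compat e₁ (C.bracket e₂ e₃) e₄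
  have h3 := C.metric_compat e₂ (C.bracket e₁ e₃) e₄
  -- The bracket is not skew: moving `e₃` in front of `[e₁, e₂]` costs a derivative along `e₄`. This
  -- supplies the fourth anchor term, as in the Cartan formula for a three-form.
  have h4 := C.bracket_swap (C.bracket e₁ e₂) e₃ e₄
  have h5 := C.metric_compat e₃ (C.bracket e₁ e₂) e₄
  linear_combination h1 + h2 - h3 + h4 + h5

end CourantAlgebroid

end Courant

/-! ### Forms on `L` and their graphs in `L ⊕ L*` -/

section Double

variable {EM : Type*} [NormedAddCommGroup EM] [NormedSpace ℝ EM] [FiniteDimensional ℝ EM]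
  {HM : Type*} [TopologicalSpace HM] {I : ModelWithCorners ℝ EM HM}
  {M : Type*} [TopologicalSpace M] [ChartedSpace HM M] [T2Space M] [IsManifold I ∞ M]
  {F : Type*} [NormedAddCommGroup F] [NormedSpace ℝ F] [FiniteDimensional ℝ F]
  {L : M → Type*} [TopologicalSpace (TotalSpace F L)]
  [∀ x, AddCommGroup (L x)] [∀ x, Module ℝ (L x)] [∀ x, TopologicalSpace (L x)]
  [FiberBundle F L] [VectorBundle ℝ F L] [ContMDiffVectorBundle ∞ F L I]

theorem flat_add_left (P Q : Form I F L 2) (s : Sec I F L) :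
    flat (P + Q) s = flat P s + flat Q s :=
  ap_ext fun t => by rw [ap_add_left, ap_flat, ap_flat, ap_flat, ev_form_add]

theorem flat_smul_left (r : ℝ) (P : Form I F L 2) (s : Sec I F L) :
    flat (r • P) s = algebraMap ℝ (SmoothFn I M) r • flat P s :=
  ap_ext fun t => by rw [ap_smul_left, ap_flat, ap_flat, ev_form_smul]

theorem flat_zero_left (s : Sec I F L) : flat (0 : Form I F L 2) s = 0 :=
  ap_ext fun t => by rw [ap_flat]; rfl

theorem form_three_ext {α β : Form I F L 3} (h : ∀ a b c, α.ev ![a, b, c] = β.ev ![a, b, c]) :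
    α = β :=
  Form.ext_ev fun s => by
    have : s = ![s 0, s 1, s 2] := by ext i : 1; fin_cases i <;> rfl
    rw [this, h]

theorem form_smul_zero {k : ℕ} (r : ℝ) : r • (0 : Form I F L k) = 0 :=
  smul_zero (M := ℝ) (A := Form I F L k) r

theorem form_zero_smul {k : ℕ} (α : Form I F L k) : (0 : ℝ) • α = 0 :=
  zero_smul (M₀ := ℝ) (A := Form I F L k) α

theorem form_smul_add {k : ℕ} (r : ℝ) (α β : Form I F L k) : r • (α + β) = r • α + r • β :=
  smul_add (M := ℝ) (A := Form I F L k) r α β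

/-- The section `a + α(a)` of the graph of a two-form `α`. -/
def graphSec (α : Form I F L 2) (a : Sec I F L) : Sec I (DoubleFiber F) (Double L) :=
  inL a + inDual (flat α a)

/-- The section `α(a)` of `L ⊕ L*`, as a real linear function of `α`. -/
def inDualFlatₗ (a : Sec I F L) :
    Form I F L 2 →ₗ[ℝ] Sec I (DoubleFiber F) (Double L) where
  toFun α := inDual (flat α a)
  map_add' α β := by rw [flat_add_left, inDual_add]
  map_smul' r α := by rw [flat_smul_left, inDual_smul]; rfl

/-- The projection `Γ(L ⊕ L*) → Γ(L)` as a real linear map. -/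
def prLₗ : Sec I (DoubleFiber F) (Double L) →ₗ[ℝ] Sec I F L where
  toFun := prL
  map_add' := prL_add
  map_smul' _ _ := rfl

/-- The value of a three-form, as a bilinear function of the form and its first argument. -/
def evThreeₗ (b c : Sec I F L) : Form I F L 3 →ₗ[ℝ] Sec I F L →ₗ[ℝ] SmoothFn I M :=
  LinearMap.mk₂ ℝ (fun η a => η.ev ![a, b, c]) (fun _ _ _ => ev_form_add _ _ _)
    (fun r η a => by rw [ev_form_smul, Algebra.smul_def])
    (fun η a a' => ev_three_add η a a' b c)
    (fun r η a => by rw [← algebraMap_smulSec, ev_three_smul, Algebra.smul_def])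

theorem pair_graphSec_right (α : Form I F L 2) (e : Sec I (DoubleFiber F) (Double L))
    (a : Sec I F L) : naturalPairing.pair e (graphSec α a) =
      ap (prDual e) a + α.ev ![a, prL e] := by
  rw [graphSec, FiberMetric.pair_add_right, pair_eq, pair_eq]
  simp [ap_zero_left, ap_zero_right, ap_flat]

/-- Write `e` as its graph part `g`, over `pr_L e`, plus a remainder `ξ` in `L*`, and `e'` likewise.
The graph and `L*` are both isotropic, so only `⟨ξ, g'⟩ + ⟨g, ξ'⟩` survives, and this equals `⟨e,
g'⟩ + ⟨e', g⟩`. It turns the pairing of two brackets in the Jacobi identity into values of the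
Maurer-Cartan form. -/
theorem pair_eq_graphSec (α : Form I F L 2) (e e' : Sec I (DoubleFiber F) (Double L)) :
    naturalPairing.pair e e' = naturalPairing.pair e (graphSec α (prL e')) +
      naturalPairing.pair e' (graphSec α (prL e)) := by
  rw [pair_graphSec_right, pair_graphSec_right, pair_eq, ev_two_swap α (prL e)]
  ring

namespace CourantAlgebroid

variable (C : CourantAlgebroid (naturalPairing (I := I) (F := F) (L := L)))

/-! ### Real multilinearity of the Schouten and triple brackets -/

theorem rhoDual_const (σ : Sec I (DualFiber F) (DualBundle L)) (c : ℝ) :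
    C.rhoDual σ (algebraMap ℝ (SmoothFn I M) c) = 0 := C.anchor.deriv_const _ _

/-- `schoutenAux` is symmetrized in its two forms. Linearity therefore needs checking in the first
argument only. -/
theorem schouten_comm (P Q : Form I F L 2) : C.schouten P Q = C.schouten Q P :=
  form_three_ext fun a b c => by
    rw [ev_schouten, ev_schouten]
    simp only [schoutenAux]
    ring

theorem schouten_add_left (P P' Q : Form I F L 2) :
    C.schouten (P + P') Q = C.schouten P Q + C.schouten P' Q :=
  form_three_ext fun a b c => by
    rw [ev_form_add, ev_schouten, ev_schouten, ev_schouten]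
    simp only [schoutenAux, flat_add_left, brDual_add_left, brDual_add_right, rhoDual_add_left,
      ev_form_add, rhoDual_add, ap_add_left]
    ring

/-- The scalar is a constant, so the terms in which the anchor differentiates it drop out. -/
theorem schouten_smul_left (r : ℝ) (P Q : Form I F L 2) :
    C.schouten (r • P) Q = r • C.schouten P Q :=
  form_three_ext fun a b c => by
    rw [ev_form_smul, ev_schouten, ev_schouten]
    simp only [schoutenAux, flat_smul_left, brDual_smul_left, brDual_smul_right,
      rhoDual_smul_left, ev_form_smul, rhoDual_mul, rhoDual_const, ap_add_left, ap_smul_left]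
    ring

/-- The Schouten bracket as a real bilinear map. -/
def schoutenₗ : Form I F L 2 →ₗ[ℝ] Form I F L 2 →ₗ[ℝ] Form I F L 3 :=
  LinearMap.mk₂ ℝ C.schouten C.schouten_add_left C.schouten_smul_left
    (fun P Q Q' => by
      rw [C.schouten_comm, schouten_add_left, C.schouten_comm Q, C.schouten_comm Q'])
    (fun r P Q => by rw [C.schouten_comm, schouten_smul_left, C.schouten_comm Q])

theorem schoutenₗ_apply (P Q : Form I F L 2) : C.schoutenₗ P Q = C.schouten P Q := rfl

/-- The definition sums over all permutations. Cyclic ones suffice to bring any argument to the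
first place, where additivity and homogeneity are proved. -/
theorem tripleBracket_rotate (P Q T : Form I F L 2) :
    C.tripleBracket P Q T = C.tripleBracket Q T P :=
  form_three_ext fun a b c => by
    rw [ev_tripleBracket, ev_tripleBracket]
    ring

theorem tripleBracket_add (P P' Q T : Form I F L 2) :
    C.tripleBracket (P + P') Q T = C.tripleBracket P Q T + C.tripleBracket P' Q T :=
  form_three_ext fun a b c => by
    have e2 (σ τ τ' υ : Sec I (DualFiber F) (DualBundle L)) :
        C.phi σ (τ + τ') υ = C.phi σ τ υ + C.phi σ τ' υ := by
      rw [C.phi_swap, C.phi_add, C.phi_swap σ, C.phi_swap σ]; ring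
    have e3 (σ τ υ υ' : Sec I (DualFiber F) (DualBundle L)) :
        C.phi σ τ (υ + υ') = C.phi σ τ υ + C.phi σ τ υ' := by
      rw [C.phi_swap', e2, C.phi_swap' σ τ, C.phi_swap' σ τ]; ring
    rw [ev_form_add, ev_tripleBracket, ev_tripleBracket, ev_tripleBracket]
    simp only [flat_add_left, C.phi_add, e2, e3]
    ring

theorem tripleBracket_smul (r : ℝ) (P Q T : Form I F L 2) :
    C.tripleBracket (r • P) Q T = r • C.tripleBracket P Q T :=
  form_three_ext fun a b c => by
    have e2 (f : SmoothFn I M) (σ τ υ : Sec I (DualFiber F) (DualBundle L)) :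
        C.phi σ (f • τ) υ = f * C.phi σ τ υ := by
      rw [C.phi_swap, C.phi_smul, C.phi_swap σ]; ring
    have e3 (f : SmoothFn I M) (σ τ υ : Sec I (DualFiber F) (DualBundle L)) :
        C.phi σ τ (f • υ) = f * C.phi σ τ υ := by
      rw [C.phi_swap', e2, C.phi_swap' σ τ]; ring
    rw [ev_form_smul, ev_tripleBracket, ev_tripleBracket]
    simp only [flat_smul_left, C.phi_smul, e2, e3]
    ring

/-- The trilinear bracket as a real trilinear map. -/
def tripleₗ : Form I F L 2 →ₗ[ℝ] Form I F L 2 →ₗ[ℝ] Form I F L 2 →ₗ[ℝ] Form I F L 3 :=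
  LinearMap.mk₂ ℝ
    (fun P Q =>
      { toFun := C.tripleBracket P Q
        map_add' := fun T T' => by
          rw [← tripleBracket_rotate, tripleBracket_add, tripleBracket_rotate C T,
            tripleBracket_rotate C T']
        map_smul' := fun r T => by
          rw [← tripleBracket_rotate, tripleBracket_smul, tripleBracket_rotate C T]; rfl })
    (fun P P' Q => LinearMap.ext fun T => C.tripleBracket_add P P' Q T)
    (fun r P Q => LinearMap.ext fun T => C.tripleBracket_smul r P Q T)
    (fun P Q Q' => LinearMap.ext fun T => by
      change C.tripleBracket P (Q + Q') T = C.tripleBracket P Q T + C.tripleBracket P Q' T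
      rw [C.tripleBracket_rotate, tripleBracket_add, C.tripleBracket_rotate P,
        C.tripleBracket_rotate P])
    (fun r P Q => LinearMap.ext fun T => by
      change C.tripleBracket P (r • Q) T = r • C.tripleBracket P Q T
      rw [C.tripleBracket_rotate, tripleBracket_smul, C.tripleBracket_rotate P])

theorem tripleₗ_apply (P Q T : Form I F L 2) : C.tripleₗ P Q T = C.tripleBracket P Q T := rfl

/-! ### The Maurer-Cartan expression of a graph -/

/-- The Maurer-Cartan expression `d_L α + ½ [α, α]_γ + ⅙ [α, α, α]_φ`. -/
def maurerCartan (α : Form I F L 2) : Form I F L 3 :=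
  C.dTwo α + (1 / 2 : ℝ) • C.schouten α α + (1 / 6 : ℝ) • C.tripleBracket α α α

/-- This is where the Dirac property enters: closure of `Γ(L)` under the bracket, with `summandL`
being the kernel of the projection to `L*`. -/
theorem prDual_bracket_inL (hL : C.IsDirac (summandL L)) (a b : Sec I F L) :
    prDual (C.bracket (inL a) (inL b)) = 0 := by
  ext1 x
  exact hL.closed (inL a) (inL b) (fun _ => rfl) (fun _ => rfl) x

/-- The Maurer-Cartan expression measures the failure of the graph to be closed under the
bracket. -/
theorem ev_maurerCartan (hL : C.IsDirac (summandL L)) (α : Form I F L 2) (a b c : Sec I F L) :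
    (C.maurerCartan α).ev ![a, b, c] =
      naturalPairing.pair (C.bracket (graphSec α a) (graphSec α b)) (graphSec α c) := by
  -- The factors `1/2` and `1/6` act as constant functions in a ring that is not a field, so their
  -- inverse relations are supplied explicitly.
  have h2 : algebraMap ℝ (SmoothFn I M) (1 / 2) * 2 = 1 := by
    rw [← map_ofNat (algebraMap ℝ (SmoothFn I M)) 2, ← map_mul]; norm_num
  have h6 : algebraMap ℝ (SmoothFn I M) (1 / 6) * 6 = 1 := by
    rw [← map_ofNat (algebraMap ℝ (SmoothFn I M)) 6, ← map_mul]; norm_num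
  have p1 (e : Sec I (DoubleFiber F) (Double L)) (s : Sec I F L) :
      naturalPairing.pair e (inL s) = ap (prDual e) s := by
    rw [pair_eq]; simp [ap_zero_left]
  have p2 (e : Sec I (DoubleFiber F) (Double L)) (σ : Sec I (DualFiber F) (DualBundle L)) :
      naturalPairing.pair e (inDual σ) = ap σ (prL e) := by
    rw [pair_eq]; simp [ap_zero_right]
  have ab_c : naturalPairing.pair (C.bracket (inL a) (inL b)) (inL c) = 0 := by
    rw [p1, C.prDual_bracket_inL hL, ap_zero_left]
  -- Metric compatibility moves the bracket with `s` onto `u`: this is the Lie derivative of `α(t)`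
  -- along `s`, evaluated on `u`.
  have mixed (s t u : Sec I F L) :
      naturalPairing.pair (C.bracket (inL s) (inDual (flat α t))) (inL u) =
        C.rhoL s (α.ev ![t, u]) - α.ev ![t, C.brL s u] := by
    have := C.metric_compat (inL s) (inDual (flat α t)) (inL u)
    rw [p1, prDual_inDual, ap_flat, FiberMetric.pair_comm _ (inDual _), p2, ap_flat] at this
    rw [rhoL, brL]
    linear_combination -this
  -- The same computation with the roles of `L` and `L*` exchanged.
  have mixed' (s t u : Sec I F L) :
      naturalPairing.pair (C.bracket (inDual (flat α s)) (inL t)) (inDual (flat α u)) =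
        C.rhoDual (flat α s) (α.ev ![u, t]) - ap (C.brDual (flat α s) (flat α u)) t := by
    have := C.metric_compat (inDual (flat α s)) (inL t) (inDual (flat α u))
    rw [p2, prL_inL, ap_flat, FiberMetric.pair_comm _ (inL _), p1] at this
    rw [rhoDual, brDual]
    linear_combination -this
  -- The three terms with exactly one entry from `L*`.
  have hd : naturalPairing.pair (C.bracket (inL a) (inDual (flat α b))) (inL c) +
      naturalPairing.pair (C.bracket (inDual (flat α a)) (inL b)) (inL c) +
      naturalPairing.pair (C.bracket (inL a) (inL b)) (inDual (flat α c)) =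
      C.dTwoFun α a b c := by
    rw [mixed, C.bracket_swap (inDual _), mixed, p2, FiberMetric.pair_comm, p2, prL_inL, ap_flat,
      ap_flat, dTwoFun, ← rhoL, ← brL, ev_two_swap α b (C.brL a c), ev_two_swap α a (C.brL b c),
      ev_two_swap α c (C.brL a b)]
    ring
  -- The three terms with exactly two entries from `L*`. On the diagonal `schoutenAux α α` counts
  -- each contribution twice, whence the factor `1/2`.
  have hs : naturalPairing.pair (C.bracket (inL a) (inDual (flat α b))) (inDual (flat α c)) +
      naturalPairing.pair (C.bracket (inDual (flat α a)) (inL b)) (inDual (flat α c)) +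
      naturalPairing.pair (C.bracket (inDual (flat α a)) (inDual (flat α b))) (inL c) =
      algebraMap ℝ (SmoothFn I M) (1 / 2) * (C.schouten α α).ev ![a, b, c] := by
    rw [C.bracket_swap (inL a), mixed', mixed', p1, p2, prL_inL, ap_flat, ← rhoDual, ← brDual,
      ev_schouten]
    simp only [schoutenAux]
    rw [C.brDual_skew (flat α a) (flat α c), ap_neg_left, ev_two_swap α b c, ev_two_swap α a b,
      C.rhoDual_neg, C.rhoDual_neg]
    linear_combination (C.rhoDual (flat α c) (α.ev ![a, b]) + C.rhoDual (flat α b) (α.ev ![c, a])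
      - ap (C.brDual (flat α b) (flat α c)) a + C.rhoDual (flat α a) (α.ev ![b, c])
      + ap (C.brDual (flat α a) (flat α c)) b - ap (C.brDual (flat α a) (flat α b)) c) * h2
  -- The term with all entries from `L*`: the six permutations agree when the forms coincide.
  have ht : naturalPairing.pair (C.bracket (inDual (flat α a)) (inDual (flat α b)))
      (inDual (flat α c)) =
      algebraMap ℝ (SmoothFn I M) (1 / 6) * (C.tripleBracket α α α).ev ![a, b, c] := by
    rw [ev_tripleBracket]
    simp only [phi]
    linear_combination -(naturalPairing.pair (C.bracket (inDual (flat α a)) (inDual (flat α b)))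
      (inDual (flat α c))) * h6
  rw [maurerCartan, ev_form_add, ev_form_add, ev_form_smul, ev_form_smul, ev_dTwo, ← hd, ← hs,
    ← ht]
  simp only [graphSec, C.bracket_add_left, C.bracket_add_right, FiberMetric.pair_add_left,
    FiberMetric.pair_add_right]
  linear_combination -ab_c

/-! ### The Bianchi identity along a graph -/

/-- The value on `(a, b, c, d)` of the differential of `η` along the graph of `α`. -/
def graphDeriv (α : Form I F L 2) (η : Form I F L 3) (a b c d : Sec I F L) : SmoothFn I M :=
  C.anchor.deriv (graphSec α a) (η.ev ![b, c, d]) - C.anchor.deriv (graphSec α b) (η.ev ![a, c, d])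
    + C.anchor.deriv (graphSec α c) (η.ev ![a, b, d])
    - C.anchor.deriv (graphSec α d) (η.ev ![a, b, c])
    - η.ev ![prL (C.bracket (graphSec α a) (graphSec α b)), c, d]
    + η.ev ![prL (C.bracket (graphSec α a) (graphSec α c)), b, d]
    - η.ev ![prL (C.bracket (graphSec α a) (graphSec α d)), b, c]
    - η.ev ![prL (C.bracket (graphSec α b) (graphSec α c)), a, d]
    + η.ev ![prL (C.bracket (graphSec α b) (graphSec α d)), a, c]
    - η.ev ![prL (C.bracket (graphSec α c) (graphSec α d)), a, b]

/-- The graph of the zero form is `L` itself, with its own anchor and bracket. -/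
theorem graphDeriv_zero (η : Form I F L 3) (a b c d : Sec I F L) :
    C.graphDeriv 0 η a b c d = C.dThreeFun η a b c d := by
  have h (s : Sec I F L) : graphSec 0 s = inL s := by
    rw [graphSec, flat_zero_left]
    exact add_zero (inL s)
  simp only [graphDeriv, h]
  rfl

/-- The Bianchi identity. -/
theorem graphDeriv_maurerCartan (hL : C.IsDirac (summandL L)) (α : Form I F L 2)
    (a b c d : Sec I F L) : C.graphDeriv α (C.maurerCartan α) a b c d = 0 := by
  -- Pairings with `graphSec α (prL _)` put the bracket in the last slot of the form, while
  -- `graphDeriv` has it in the first; a cyclic permutation of three entries is even.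
  have cyc (η : Form I F L 3) (p s t : Sec I F L) : η.ev ![p, s, t] = η.ev ![s, t, p] := by
    rw [ev_three_swap η s p, ev_three_swap' η s t p]; ring
  -- The right-hand zero is replaced by the Jacobi expression on the four graph sections. Each of
  -- its three pairings of brackets splits into two, giving the six bracket terms of `graphDeriv`.
  rw [← C.pair_jacobi (graphSec α a) (graphSec α b) (graphSec α c) (graphSec α d),
    pair_eq_graphSec α (C.bracket (graphSec α a) (graphSec α b))
      (C.bracket (graphSec α c) (graphSec α d)),
    pair_eq_graphSec α (C.bracket (graphSec α a) (graphSec α c))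
      (C.bracket (graphSec α b) (graphSec α d)),
    pair_eq_graphSec α (C.bracket (graphSec α b) (graphSec α c))
      (C.bracket (graphSec α a) (graphSec α d))]
  simp only [← C.ev_maurerCartan hL, graphDeriv, cyc _ (prL _)]
  ring

/-- Homogeneity over constants is what allows the factor `t ^ (N + 1)` to be divided out of the
Bianchi identity. -/
theorem graphDeriv_smul (α : Form I F L 2) (r : ℝ) (η : Form I F L 3) (a b c d : Sec I F L) :
    C.graphDeriv α (r • η) a b c d =
      algebraMap ℝ (SmoothFn I M) r * C.graphDeriv α η a b c d := by
  simp only [graphDeriv, ev_form_smul, C.anchor.deriv_mul, C.anchor.deriv_const]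
  ring

/-- The graph sections are affine in `α`, and every term is built from them and `η` by real
multilinear maps. -/
theorem polyCurve_graphDeriv {α : ℝ → Form I F L 2} {η : ℝ → Form I F L 3}
    (hα : α ∈ polyCurve _) (hη : η ∈ polyCurve _) (a b c d : Sec I F L) :
    (fun t => C.graphDeriv (α t) (η t) a b c d) ∈ polyCurve (SmoothFn I M) := by
  have hg (s : Sec I F L) : (fun t => graphSec (α t) s) ∈ polyCurve _ :=
    polyCurve_add (polyCurve_const (inL s)) (polyCurve_map (inDualFlatₗ s) hα)
  have h1 (s p q r : Sec I F L) :
      (fun t => C.anchor.deriv (graphSec (α t) s) ((η t).ev ![p, q, r])) ∈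
        polyCurve (SmoothFn I M) :=
    polyCurve_map₂ C.anchor.derivₗ (hg s) (polyCurve_map ((evThreeₗ q r).flip p) hη)
  have h2 (s p q r : Sec I F L) :
      (fun t => (η t).ev ![prL (C.bracket (graphSec (α t) s) (graphSec (α t) p)), q, r]) ∈
        polyCurve (SmoothFn I M) :=
    polyCurve_map₂ (evThreeₗ q r) hη (polyCurve_map prLₗ (polyCurve_map₂ C.bracketₗ (hg s) (hg p)))
  unfold graphDeriv
  exact polyCurve_sub (polyCurve_add (polyCurve_sub (polyCurve_sub (polyCurve_add (polyCurve_sub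
    (polyCurve_sub (polyCurve_add (polyCurve_sub (h1 _ _ _ _) (h1 _ _ _ _)) (h1 _ _ _ _))
    (h1 _ _ _ _)) (h2 _ _ _ _)) (h2 _ _ _ _)) (h2 _ _ _ _)) (h2 _ _ _ _)) (h2 _ _ _ _))
    (h2 _ _ _ _)

/-! ### Expansion in `t` and closedness of the first obstruction -/

theorem schouten_zero_left (Q : Form I F L 2) : C.schouten 0 Q = 0 :=
  C.schoutenₗ.map_zero₂ Q

theorem schouten_zero_right (P : Form I F L 2) : C.schouten P 0 = 0 :=
  (C.schoutenₗ P).map_zero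

theorem tripleBracket_zero_left (Q T : Form I F L 2) : C.tripleBracket 0 Q T = 0 := by
  have := C.tripleBracket_smul 0 0 Q T
  rwa [form_zero_smul, form_zero_smul] at this

theorem tripleBracket_zero_mid (P T : Form I F L 2) : C.tripleBracket P 0 T = 0 := by
  rw [tripleBracket_rotate, tripleBracket_zero_left]

theorem tripleBracket_zero_right (P Q : Form I F L 2) : C.tripleBracket P Q 0 = 0 := by
  rw [tripleBracket_rotate, tripleBracket_zero_mid]

/-- The expression is cubic, so `3 * K` coefficients suffice; the linear and quadratic terms are
padded with zeros to the same range. -/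
theorem maurerCartan_sum {K : ℕ} {w : ℕ → Form I F L 2} (hw : ∀ r, K ≤ r → w r = 0) (t : ℝ) :
    C.maurerCartan (∑ i ∈ Finset.range K, t ^ i • w i) =
      ∑ n ∈ Finset.range (3 * K), t ^ n • C.mcCoeff w n := by
  have hd := map_sum_pow_smul C.dTwo (m := 3 * K) (by omega) hw t
  have hs := map₂_sum_pow_smul C.schoutenₗ (m := 3 * K) (by omega) hw hw t
  have ht := map₃_sum_pow_smul C.tripleₗ hw t
  simp only [schoutenₗ_apply, tripleₗ_apply] at hs ht
  simp only [maurerCartan, mcCoeff]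
  rw [hd, hs, ht, Finset.smul_sum, Finset.smul_sum, ← Finset.sum_add_distrib,
    ← Finset.sum_add_distrib]
  refine Finset.sum_congr rfl fun n _ => ?_
  rw [form_smul_add, form_smul_add, smul_comm (1 / 2 : ℝ), smul_comm (1 / 6 : ℝ)]

/-- The first obstructing coefficient of the Maurer-Cartan equation is closed. -/
theorem dThree_mcCoeff (hL : C.IsDirac (summandL L)) {N : ℕ} {w : ℕ → Form I F L 2}
    (hw : C.IsFormalDeformation N w) : C.dThree (C.mcCoeff w (N + 1)) = 0 := by
  -- Evaluating at a point reduces the limit `t → 0` to real polynomials.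
  refine Form.ext_ev fun s => ContMDiffMap.ext fun x => ?_
  let α : ℝ → Form I F L 2 := fun t => ∑ i ∈ Finset.range (N + 1), t ^ i • w i
  -- The Maurer-Cartan polynomial has `3 * (N + 1)` coefficients; after the first `N + 1`, which
  -- vanish, `2 * N + 2` remain.
  let η : ℝ → Form I F L 3 := fun t =>
    ∑ n ∈ Finset.range (2 * N + 2), t ^ n • C.mcCoeff w (N + 1 + n)
  have hMC (t : ℝ) : C.maurerCartan (α t) = t ^ (N + 1) • η t := by
    rw [C.maurerCartan_sum (fun r hr => hw.eq_zero_of_lt r hr),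
      show 3 * (N + 1) = (N + 1) + (2 * N + 2) by omega, Finset.sum_range_add,
      Finset.sum_eq_zero, zero_add, Finset.smul_sum]
    · simp only [smul_smul, pow_add]
    · intro n hn
      rw [hw.equation n (by simpa [Nat.lt_succ_iff] using hn), form_smul_zero]
  -- The term of index `0` carries `0 ^ 0 = 1`, so it vanishes only because `w 0 = 0`.
  have hα0 : α 0 = 0 := Finset.sum_eq_zero fun i _ => by
    rcases i with - | i
    · rw [hw.zero, form_smul_zero]
    · rw [zero_pow (Nat.succ_ne_zero i), form_zero_smul]
  have hη0 : η 0 = C.mcCoeff w (N + 1) := by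
    refine (Finset.sum_eq_single 0 (fun n _ hn => ?_) fun h => ?_).trans ?_
    · rw [zero_pow hn, form_zero_smul]
    · simp at h
    · rw [pow_zero, one_smul, add_zero]
  let evx : SmoothFn I M →ₗ[ℝ] ℝ :=
    { toFun := fun f => f x
      map_add' := fun _ _ => rfl
      map_smul' := fun _ _ => rfl }
  have hpoly := polyCurve_map evx
    (C.polyCurve_graphDeriv (polyCurve_sum (Finset.range (N + 1)) id w)
      (polyCurve_sum (Finset.range (2 * N + 2)) id fun n => C.mcCoeff w (N + 1 + n))
      (s 0) (s 1) (s 2) (s 3))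
  -- For `t ≠ 0` the Bianchi identity for `α t` is divided by `t ^ (N + 1)`; the result then passes
  -- to `t = 0`.
  have h0 := polyCurve_apply_zero hpoly fun t ht => by
    have h1 := C.graphDeriv_maurerCartan hL (α t) (s 0) (s 1) (s 2) (s 3)
    rw [hMC, graphDeriv_smul] at h1
    have h2 : t ^ (N + 1) * C.graphDeriv (α t) (η t) (s 0) (s 1) (s 2) (s 3) x = 0 :=
      congrArg (fun f : SmoothFn I M => f x) h1
    exact (mul_eq_zero.1 h2).resolve_left (pow_ne_zero _ ht)
  change C.graphDeriv (α 0) (η 0) (s 0) (s 1) (s 2) (s 3) x = 0 at h0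
  rw [hα0, hη0, graphDeriv_zero, ← ev_dThreeForm] at h0
  exact h0

/-! ### The remainder, extension and cohomology -/

theorem mcCoeff_congr {w w' : ℕ → Form I F L 2} {n : ℕ} (h : ∀ r ≤ n, w' r = w r) :
    C.mcCoeff w' n = C.mcCoeff w n := by
  simp only [mcCoeff]
  congr 2
  · rw [h n le_rfl]
  · refine congrArg _ (Finset.sum_congr rfl fun p hp => ?_)
    have := Finset.HasAntidiagonal.mem_antidiagonal.1 hp
    rw [h p.1 (by omega), h p.2 (by omega)]
  · refine Finset.sum_congr rfl fun p hp => Finset.sum_congr rfl fun q hq => ?_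
    have := Finset.HasAntidiagonal.mem_antidiagonal.1 hp
    have := Finset.HasAntidiagonal.mem_antidiagonal.1 hq
    rw [h p.1 (by omega), h q.1 (by omega), h q.2 (by omega)]

/-- In total degree `N + 1` an index `N + 1` forces the other indices to be `0`, where the
coefficient vanishes. The brackets therefore involve only indices from `1` to `N`, and the new
coefficient appears only under `d_L`. -/
theorem mcCoeff_succ {N : ℕ} {w w' : ℕ → Form I F L 2} (h0 : w 0 = 0)
    (h : ∀ r ≤ N, w' r = w r) :
    C.mcCoeff w' (N + 1) = C.dTwo (w' (N + 1)) - C.remainder N w := by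
  have h0' : w' 0 = 0 := (h 0 (Nat.zero_le N)).trans h0
  have hs : ∑ i ∈ Finset.Icc 1 N, C.schouten (w i) (w (N + 1 - i)) =
      ∑ p ∈ Finset.HasAntidiagonal.antidiagonal (N + 1), C.schouten (w' p.1) (w' p.2) := by
    -- The pairs missed by this map are the two ends of the antidiagonal, each with a zero index.
    refine Finset.sum_of_injOn (fun i => (i, N + 1 - i)) (fun i _ j _ hij => congrArg Prod.fst hij)
      (fun i hi => ?_) (fun p hp hp' => ?_) fun i hi => ?_
    · simp only [Finset.coe_Icc, Set.mem_Icc] at hi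
      simp only [Finset.mem_coe, Finset.HasAntidiagonal.mem_antidiagonal]
      omega
    · have hp := Finset.HasAntidiagonal.mem_antidiagonal.1 hp
      by_cases h1 : p.1 = 0
      · rw [h1, h0', schouten_zero_left]
      by_cases h2 : p.2 = 0
      · rw [h2, h0', schouten_zero_right]
      refine absurd ⟨p.1, ?_, Prod.ext rfl ?_⟩ hp'
      · simp only [Finset.coe_Icc, Set.mem_Icc]
        omega
      · change N + 1 - p.1 = p.2
        omega
    · have hi := Finset.mem_Icc.1 hi
      rw [h i hi.2, h (N + 1 - i) (by omega)]
  have ht : ∑ p ∈ (Finset.Icc 1 N ×ˢ Finset.Icc 1 N ×ˢ Finset.Icc 1 N).filter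
      (fun p => p.1 + p.2.1 + p.2.2 = N + 1), C.tripleBracket (w p.1) (w p.2.1) (w p.2.2) =
      ∑ p ∈ Finset.HasAntidiagonal.antidiagonal (N + 1),
        ∑ q ∈ Finset.HasAntidiagonal.antidiagonal p.2,
          C.tripleBracket (w' p.1) (w' q.1) (w' q.2) := by
    rw [Finset.sum_sigma']
    -- A triple `(i, j, k)` goes to the splitting of `N + 1` as `i + (j + k)`, followed by that of
    -- `j + k`; the triples missed contain a zero index.
    refine Finset.sum_of_injOn (fun p => ⟨(p.1, p.2.1 + p.2.2), p.2⟩)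
      (fun p _ q _ hpq => ?_) (fun p hp => ?_) (fun p hp hp' => ?_) fun p hp => ?_
    · simp only [Sigma.mk.injEq, Prod.mk.injEq, heq_eq_eq] at hpq
      exact Prod.ext hpq.1.1 hpq.2
    · simp only [Finset.mem_coe, Finset.mem_filter, Finset.mem_sigma,
        Finset.mem_product, Finset.mem_Icc, Finset.HasAntidiagonal.mem_antidiagonal,
        and_true] at hp ⊢
      omega
    · obtain ⟨⟨i, m⟩, j, k⟩ := p
      simp only [Finset.mem_sigma, Finset.HasAntidiagonal.mem_antidiagonal] at hp ⊢
      obtain ⟨hp1, rfl⟩ := hp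
      by_cases h1 : i = 0
      · rw [h1, h0', tripleBracket_zero_left]
      by_cases h2 : j = 0
      · rw [h2, h0', tripleBracket_zero_mid]
      by_cases h3 : k = 0
      · rw [h3, h0', tripleBracket_zero_right]
      refine absurd ⟨(i, j, k), ?_, rfl⟩ hp'
      simp only [Finset.mem_coe, Finset.mem_filter, Finset.mem_product, Finset.mem_Icc]
      omega
    · simp only [Finset.mem_filter, Finset.mem_product, Finset.mem_Icc] at hp
      dsimp only
      rw [h p.1 (by omega), h p.2.1 (by omega), h p.2.2 (by omega)]
  rw [mcCoeff, remainder, hs, ht]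
  abel

/-- Taking `w' = w` in `mcCoeff_succ`, where `w (N + 1) = 0`, identifies the first obstructing
coefficient with minus the remainder. -/
theorem remainder_mem_ker (hL : C.IsDirac (summandL L)) {N : ℕ} {w : ℕ → Form I F L 2}
    (hw : C.IsFormalDeformation N w) : C.remainder N w ∈ LinearMap.ker C.dThree := by
  have h := C.dThree_mcCoeff hL hw
  rw [C.mcCoeff_succ hw.zero fun _ _ => rfl, hw.eq_zero_of_lt _ (Nat.lt_succ_self N), map_zero,
    zero_sub, map_neg, neg_eq_zero] at h
  exact h

theorem extends_iff {N : ℕ} {w : ℕ → Form I F L 2} (hw : C.IsFormalDeformation N w) :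
    C.Extends N w ↔ ∃ η : Form I F L 2, C.dTwo η = C.remainder N w := by
  constructor
  · rintro ⟨w', hw', h⟩
    refine ⟨w' (N + 1), sub_eq_zero.1 ?_⟩
    rw [← C.mcCoeff_succ hw.zero h, hw'.equation _ le_rfl]
  · rintro ⟨η, hη⟩
    have h (r : ℕ) (hr : r ≤ N) : Function.update w (N + 1) η r = w r :=
      Function.update_of_ne (by omega) _ _
    -- A primitive of the remainder serves as the new coefficient: it cancels the coefficient of `t
    -- ^ (N + 1)` and leaves the lower ones unchanged.
    refine ⟨Function.update w (N + 1) η, ⟨?_, fun r hr => ?_, fun n hn => ?_⟩, h⟩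
    · rw [h 0 (Nat.zero_le N), hw.zero]
    · rw [Function.update_of_ne (by omega), hw.eq_zero_of_lt r (by omega)]
    · rcases hn.lt_or_eq with hn | rfl
      · rw [C.mcCoeff_congr fun r hr => h r (by omega), hw.equation n (by omega)]
      · rw [C.mcCoeff_succ hw.zero h, Function.update_self, hη, sub_self]

/-- The quotient is by the exact forms that are closed, that is, by the preimage of the range of
`d_L` in its kernel; thus `d_L ∘ d_L = 0` is not needed. -/
theorem cohomologyClass_eq_zero_iff (η : LinearMap.ker C.dThree) :
    C.cohomologyClass η = 0 ↔ ∃ α : Form I F L 2, C.dTwo α = η :=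
  Submodule.Quotient.mk_eq_zero _

end CourantAlgebroid

end Double

end DiracDeformation

end

theorem mainTheorem1
    {EM : Type*} [NormedAddCommGroup EM] [NormedSpace ℝ EM] [FiniteDimensional ℝ EM]
    {HM : Type*} [TopologicalSpace HM] (I : ModelWithCorners ℝ EM HM)
    {M : Type*} [TopologicalSpace M] [ChartedSpace HM M] [T2Space M] [IsManifold I ∞ M]
    (F : Type*) [NormedAddCommGroup F] [NormedSpace ℝ F] [FiniteDimensional ℝ F]
    (L : M → Type*) [TopologicalSpace (TotalSpace F L)]
    [∀ x, AddCommGroup (L x)] [∀ x, Module ℝ (L x)] [∀ x, TopologicalSpace (L x)]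
    [FiberBundle F L] [VectorBundle ℝ F L] [ContMDiffVectorBundle ∞ F L I]
    (C : DiracDeformation.CourantAlgebroid
      (DiracDeformation.naturalPairing (I := I) (F := F) (L := L)))
    (hL : C.IsDirac (DiracDeformation.summandL L))
    (N : ℕ) (w : ℕ → DiracDeformation.Form I F L 2) (hw : C.IsFormalDeformation N w) :
    ∃ hR : C.remainder N w ∈ LinearMap.ker C.dThree,
      (C.Extends N w ↔ ∃ η : DiracDeformation.Form I F L 2, C.dTwo η = C.remainder N w) ∧
      (C.Extends N w ↔ C.cohomologyClass ⟨C.remainder N w, hR⟩ = 0) := by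
  have hR := C.remainder_mem_ker hL hw
  exact ⟨hR, C.extends_iff hw,
    (C.extends_iff hw).trans (C.cohomologyClass_eq_zero_iff ⟨_, hR⟩).symm⟩
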